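/- **Setting.** Let $a>0$ and $0<|\alpha|<1$. Let $0=x_0<x_1<\dots<x_n=a$ be nodes with multiplicities $m_l\ge 1$, where $m_0=m_n=s+1$ ($s\ge 0$ an integer), and put $M=\sum_{l=0}^n m_l-1$ and $\kappa=\max_l m_l$. Let $r\ge s+2$ be an integer with $r\ge \kappa-1$. Let $f\in C^{r}[0,a]$ be complex-valued, and let $g\in C^{r+1}[0,a]$ be real-valued with $g(0)=0$ and $g'>0$ on $[0,a]$; both are independent of $w$. Let $\phi_1,\dots,\phi_M\in C^{r+1}[0,a]$ be complex-valued functions, independent of $w$, forming a Chebyshev set in the sense appropriate to confluent nodes: every nontrivial linear combination of $\phi_1,\dots,\phi_M$ has at most $M-1$ zeros in $[0,a]$, each zero being counted with its multiplicity up to at most $\kappa$. (If all $m_l=1$ this is the usual Haar condition. Derivatives at the end points are one-sided.) For real $w$, $c_0\in\mathbb C$ and $q_1=\sum_{k=1}^M c_k\phi_k$ with $c_k\in\mathbb C$, let $$\mathcal W[c_0,q_1]=iwg'c_0+g\,q_1'+(1+\alpha+iwg)\,g'q_1,\qquad f_1(x)=\begin{cases} f(x)\,(x/g(x))^{\alpha},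 & x\ne 0,\\ f(0)/g'(0)^{\alpha}, & x=0.\end{cases}$$ The collocation system for the unknowns $(c_0,c_1,\dots,c_M)$ is $$\frac{d^{j}\mathcal W[c_0,q_1]}{dx^{j}}(x_l)=f_1^{(j)}(x_l),\qquad 0\le j\le m_l-1,\quad 0\le l\le n. \tag{1}$$ Given a solution of (1), let $$h(x)=\alpha c_0e^{-iwg(x)}\int_0^x\frac{g'(t)\,(1-e^{iwg(t)})}{g(t)^{1-\alpha}}\,dt,$$ and define the Levin rule $$Q^{L,s}_{w,\alpha,n}[f]=\Bigl[\bigl(g^{\alpha+1}(x)q_1(x)+c_0(1-e^{-iwg(x)})g^{\alpha}(x)+h(x)\bigr)e^{iwg(x)}\Bigr]_{x=0}^{x=a},$$ where the bracketed function is given its limit $0$ at $x=0$. **Theorem.** There are constants $w_0$ and $C$, independent of $w$, such that for all real $w$ with $|w|\ge w_0$ the system (1) has a unique solution and $$\Bigl|\int_0^a f(x)x^{\alpha}e^{iwg(x)}\,dx-Q^{L,s}_{w,\alpha,n}[f]\Bigr|\le C\,|w|^{-s-1-\min\{1+\alpha,1\}}.$$ -/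

import Mathlib

open Set

noncomputable section

namespace Levin

/-- The linear combination `∑ c_k φ_k` of the basis functions. -/
def lin {M : ℕ} (φ : Fin M → ℝ → ℂ) (c : Fin M → ℂ) (x : ℝ) : ℂ :=
  ∑ k, c k * φ k x

/-- `φ` is a Chebyshev set on `[0, a]`, zeros being counted with multiplicities up to `κ`:
a nontrivial linear combination of the `M` functions has at most `M - 1` zeros in `[0, a]`.
Here `T` is a finite set of points, and the combination vanishes at each `t ∈ T` with
multiplicity at least `μ t`, that is, together with its derivatives of order `< μ t`
(one-sided at the end points).  For `κ = 1` this is the classical Haar condition.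
For real-valued `φ`, complex and real coefficients give the same notion (take real and
imaginary parts of the coefficients). -/
def IsChebyshevSet (a : ℝ) (κ : ℕ) {M : ℕ} (φ : Fin M → ℝ → ℂ) : Prop :=
  ∀ c : Fin M → ℂ, c ≠ 0 → ∀ (T : Finset ℝ) (μ : ℝ → ℕ),
    (∀ t ∈ T, t ∈ Icc 0 a ∧ μ t ≤ κ ∧
      ∀ j < μ t, iteratedDerivWithin j (lin φ c) (Icc 0 a) t = 0) →
    ∑ t ∈ T, μ t < M

/-- The transformed right-hand side: `f(x) (x / g(x)) ^ α` for `x ≠ 0`, and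
`f(0) / g'(0) ^ α` for `x = 0`. -/
def rhs (a α : ℝ) (f : ℝ → ℂ) (g : ℝ → ℝ) (x : ℝ) : ℂ :=
  if x = 0 then f 0 / ((derivWithin g (Icc 0 a) 0 ^ α : ℝ) : ℂ)
  else f x * (((x / g x) ^ α : ℝ) : ℂ)

/-- The operator `𝓦[c₀, q] = i w g' c₀ + g q' + (1 + α + i w g) g' q` on `[0, a]`. -/
def W (a α w : ℝ) (g : ℝ → ℝ) (c₀ : ℂ) (q : ℝ → ℂ) (x : ℝ) : ℂ :=
  Complex.I * (w : ℂ) * ((derivWithin g (Icc 0 a) x : ℝ) : ℂ) * c₀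
    + (g x : ℂ) * derivWithin q (Icc 0 a) x
    + (1 + (α : ℂ) + Complex.I * (w : ℂ) * (g x : ℂ))
      * ((derivWithin g (Icc 0 a) x : ℝ) : ℂ) * q x

/-- The confluent collocation system for the unknowns `c₀` and `c = (c_1, …, c_M)`, with
nodes `x_l` of multiplicity `m_l`. -/
def IsCollocationSolution (a α w : ℝ) (f : ℝ → ℂ) (g : ℝ → ℝ) {M n : ℕ}
    (φ : Fin M → ℝ → ℂ) (x : Fin (n + 1) → ℝ) (m : Fin (n + 1) → ℕ)
    (c₀ : ℂ) (c : Fin M → ℂ) : Prop :=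
  ∀ l : Fin (n + 1), ∀ j < m l,
    iteratedDerivWithin j (W a α w g c₀ (lin φ c)) (Icc 0 a) (x l)
      = iteratedDerivWithin j (rhs a α f g) (Icc 0 a) (x l)

/-- The explicit solution, with `h(0) = 0`, of
`h' + i w g' h + α c₀ g' (1 - exp(-i w g)) / g ^ (1 - α) = 0`. -/
def h (a α w : ℝ) (g : ℝ → ℝ) (c₀ : ℂ) (x : ℝ) : ℂ :=
  (α : ℂ) * c₀ * Complex.exp (-(Complex.I * (w : ℂ) * (g x : ℂ)))
    * ∫ t in (0 : ℝ)..x,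
        ((derivWithin g (Icc 0 a) t : ℝ) : ℂ)
          * (1 - Complex.exp (Complex.I * (w : ℂ) * (g t : ℂ)))
          / (((g t) ^ (1 - α) : ℝ) : ℂ)

/-- The function
`(g ^ (α + 1) q + c₀ (1 - exp(-i w g)) g ^ α + h) exp(i w g)`. -/
def primitive (a α w : ℝ) (g : ℝ → ℝ) (c₀ : ℂ) (q : ℝ → ℂ) (x : ℝ) : ℂ :=
  ((((g x) ^ (α + 1) : ℝ) : ℂ) * q x
    + c₀ * (1 - Complex.exp (-(Complex.I * (w : ℂ) * (g x : ℂ)))) * (((g x) ^ α : ℝ) : ℂ)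
    + h a α w g c₀ x) * Complex.exp (Complex.I * (w : ℂ) * (g x : ℂ))

/-- The value of the Levin rule obtained from `c₀` and `q`. -/
def rule (a α w : ℝ) (g : ℝ → ℝ) (c₀ : ℂ) (q : ℝ → ℂ) : ℂ :=
  primitive a α w g c₀ q a - primitive a α w g c₀ q 0

/-- The oscillatory integral `∫_0^a f(x) x ^ α exp(i w g(x)) dx`. -/
def oscIntegral (a α w : ℝ) (f : ℝ → ℂ) (g : ℝ → ℝ) : ℂ :=
  ∫ x in (0 : ℝ)..a, f x * ((x ^ α : ℝ) : ℂ) * Complex.exp (Complex.I * (w : ℂ) * (g x : ℂ))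

end Levin

end

/-! Write g = tG with G positive and C^r. Then f x^α = f₁ g^α with f₁ = f G^(-α) of class C^r. The
Levin rule is exactly the integral of 𝓦[c₀, q₁] g^α e^{iwg}, because h cancels the term α c₀ g'
g^(α-1) (1 - e^{-iwg}) produced by differentiating g^α. Hence the error is the oscillatory integral
of the defect f₁ - 𝓦[c₀, q₁], which by collocation vanishes to order s + 1 at both ends.

Decay: an amplitude with zeros of order N at both ends admits N integrations by parts, each gaining
1/w, and what remains is O(|w|^(-min(1+α,1))) (`exists_norm_weightedOsc_le`).

Uniformity: 𝓦 = iw · principal + remainder, with principal part g'(c₀ + g q₁). If its jets vanish at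
all nodes, the value at 0 gives c₀ = 0; as g has only a simple zero at 0, q₁ then has M zeros with
multiplicity, so it is trivial (`injective_nodeJets_principal`). For large |w| the square system is
therefore uniquely solvable and w(c₀, c) stays bounded (`exists_bound_of_perturbation`). The defect
is the image, under a linear map independent of w, of the bounded vector (1, wp, p), p = (c₀, c), in
a finite-dimensional space, where Banach–Steinhaus makes the decay constant uniform
(`exists_norm_oscFunctional_le_mul_norm`). -/

noncomputable section

namespace Levin

/-! ### Hadamard's lemma on a compact interval, with one-sided derivatives. -/

section Hadamard

variable {E : Type*} [NormedAddCommGroup E] [NormedSpace ℝ E]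

/-- A `C^k` function on a compact interval is the restriction of a `C^k` function on the line. -/
lemma exists_contDiff_extension [CompleteSpace E] {a : ℝ} (ha : 0 < a) (k : ℕ) :
    ∀ u : ℝ → E, ContDiffOn ℝ k u (Icc 0 a) →
      ∃ U : ℝ → E, ContDiff ℝ k U ∧ EqOn u U (Icc 0 a) := by
  induction k with
  | zero =>
    intro u hu
    refine ⟨IccExtend ha.le ((Icc 0 a).domRestrict u), ?_, fun t ht => ?_⟩
    · rw [Nat.cast_zero, contDiff_zero]
      exact (continuousOn_iff_continuous_domRestrict.1 hu.continuousOn).Icc_extend'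
    · rw [IccExtend_of_mem _ _ ht]; rfl
  | succ k ih =>
    intro u hu
    have hI := uniqueDiffOn_Icc ha
    -- Extend the derivative by induction and integrate the extension.
    obtain ⟨V, hV, hVu⟩ := ih (derivWithin u (Icc 0 a))
      (hu.derivWithin hI (by norm_cast))
    have hd : ∀ t, HasDerivAt (fun y => u 0 + ∫ τ in (0 : ℝ)..y, V τ) (V t) t := fun t =>
      (intervalIntegral.integral_hasDerivAt_right (hV.continuous.intervalIntegrable _ _)
        hV.continuous.aestronglyMeasurable.stronglyMeasurableAtFilter
        hV.continuous.continuousAt).const_add _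
    refine ⟨fun y => u 0 + ∫ τ in (0 : ℝ)..y, V τ, ?_, fun t ht => ?_⟩
    · rw [Nat.cast_succ, contDiff_succ_iff_deriv]
      refine ⟨fun t => (hd t).differentiableAt, by simp, ?_⟩
      rwa [show deriv (fun y => u 0 + ∫ τ in (0 : ℝ)..y, V τ) = V from
        funext fun t => (hd t).deriv]
    · have hdu : DifferentiableOn ℝ u (Icc 0 a) := hu.differentiableOn (by simp)
      have h2 : ∫ τ in (0 : ℝ)..t, V τ = u t - u 0 := by
        refine intervalIntegral.integral_eq_sub_of_hasDerivAt_of_le ht.1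
          (hu.continuousOn.mono (Icc_subset_Icc_right ht.2)) (fun τ hτ => ?_)
          (hV.continuous.intervalIntegrable _ _)
        have hτ' : τ ∈ Icc 0 a := ⟨hτ.1.le, hτ.2.le.trans ht.2⟩
        rw [← hVu hτ']
        exact (hdu τ hτ').hasDerivWithinAt.hasDerivAt
          (Icc_mem_nhds hτ.1 (hτ.2.trans_le ht.2))
      simp [h2]

/-- Weighted averages over the segment `[0, x]` of a `C^k` function are `C^k` in `x`. -/
lemma contDiff_integral_dilation (k : ℕ) :
    ∀ (j : ℕ) (V : ℝ → E), ContDiff ℝ k V →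
      ContDiff ℝ k fun y => ∫ t in (0 : ℝ)..1, t ^ j • V (t * y) := by
  induction k with
  | zero =>
    intro j V hV
    rw [Nat.cast_zero, contDiff_zero] at *
    exact intervalIntegral.continuous_parametric_intervalIntegral_of_continuous' (by fun_prop) _ _
  | succ k ih =>
    intro j V hV
    have hV' : Continuous (deriv V) := hV.continuous_deriv (by simp)
    have hVd : Differentiable ℝ V := hV.differentiable (by simp)
    have hVc := hV.continuous
    -- Each derivative in `y` brings out a factor `t`, hence the weight `t ^ j` in the induction.
    have hd : ∀ y, HasDerivAt (fun y => ∫ t in (0 : ℝ)..1, t ^ j • V (t * y))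
        (∫ t in (0 : ℝ)..1, t ^ (j + 1) • deriv V (t * y)) y := by
      intro y
      obtain ⟨B, hB⟩ := (isCompact_Icc (a := -(|y| + 1)) (b := |y| + 1)).exists_bound_of_continuousOn
        hV'.continuousOn
      refine (intervalIntegral.hasDerivAt_integral_of_dominated_loc_of_deriv_le
        (F' := fun z t => t ^ (j + 1) • deriv V (t * z)) (bound := fun _ => B)
        (Metric.ball_mem_nhds y one_pos) ?_ ?_ ?_ ?_ ?_ ?_).2
      · exact Filter.Eventually.of_forall fun z =>
          (show Continuous fun t => t ^ j • V (t * z) by fun_prop).aestronglyMeasurable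
      · exact (show Continuous fun t => t ^ j • V (t * y) by fun_prop).intervalIntegrable _ _
      · exact (show Continuous fun t => t ^ (j + 1) • deriv V (t * y) by
          fun_prop).aestronglyMeasurable
      · refine Filter.Eventually.of_forall fun t ht z hz => ?_
        rw [uIoc_of_le zero_le_one] at ht
        rw [Metric.mem_ball, Real.dist_eq] at hz
        have hz1 : |z| ≤ |y| + 1 := by
          have := abs_sub_abs_le_abs_sub z y; linarith
        have h3 : |t * z| ≤ |y| + 1 := by
          rw [abs_mul, abs_of_pos ht.1]
          exact (mul_le_of_le_one_left (abs_nonneg z) ht.2).trans hz1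
        rw [norm_smul, norm_pow, Real.norm_of_nonneg ht.1.le]
        calc t ^ (j + 1) * ‖deriv V (t * z)‖ ≤ 1 * ‖deriv V (t * z)‖ := by
              gcongr; exact pow_le_one₀ ht.1.le ht.2
          _ ≤ B := by rw [one_mul]; exact hB _ (abs_le.1 h3)
      · exact intervalIntegrable_const
      · refine Filter.Eventually.of_forall fun t _ z _ => ?_
        have := ((hVd (t * z)).hasDerivAt.scomp z ((hasDerivAt_id z).const_mul t)).const_smul (t ^ j)
        simpa [pow_succ, smul_smul, Function.comp_def, Pi.smul_def] using this
    rw [Nat.cast_succ, contDiff_succ_iff_deriv]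
    refine ⟨fun t => (hd t).differentiableAt, by simp, ?_⟩
    rw [show deriv (fun y => ∫ t in (0 : ℝ)..1, t ^ j • V (t * y)) =
      fun y => ∫ t in (0 : ℝ)..1, t ^ (j + 1) • deriv V (t * y) from funext fun t => (hd t).deriv]
    rw [Nat.cast_succ, contDiff_succ_iff_deriv] at hV
    exact ih (j + 1) _ hV.2.2

/-- Hadamard's lemma on `[0, a]`. -/
lemma exists_eq_id_smul [CompleteSpace E] {a : ℝ} (ha : 0 < a) {k : ℕ} {u : ℝ → E}
    (hu : ContDiffOn ℝ (k + 1 : ℕ) u (Icc 0 a)) (hu0 : u 0 = 0) :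
    ∃ v : ℝ → E, ContDiffOn ℝ k v (Icc 0 a) ∧ v 0 = derivWithin u (Icc 0 a) 0 ∧
      ∀ t ∈ Icc 0 a, u t = t • v t := by
  obtain ⟨U, hU, hUu⟩ := exists_contDiff_extension ha (k + 1) u hu
  have h0 : (0 : ℝ) ∈ Icc 0 a := ⟨le_rfl, ha.le⟩
  have hU' : ContDiff ℝ k (deriv U) := by
    rw [Nat.cast_succ, contDiff_succ_iff_deriv] at hU
    exact hU.2.2
  have hUd : Differentiable ℝ U := hU.differentiable (by simp)
  -- The quotient is the mean of U' over the segment from 0 to `y`.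
  refine ⟨fun y => ∫ t in (0 : ℝ)..1, t ^ 0 • deriv U (t * y),
    (contDiff_integral_dilation k 0 _ hU').contDiffOn, ?_, fun t ht => ?_⟩
  · rw [derivWithin_congr hUu (hUu h0),
      (hUd 0).derivWithin (uniqueDiffOn_Icc ha 0 h0)]
    simp
  · have h1 := intervalIntegral.smul_integral_comp_mul_right (fun τ => deriv U τ) t
      (a := 0) (b := 1)
    simp only [pow_zero, one_smul]
    rw [h1, zero_mul, one_mul, intervalIntegral.integral_deriv_eq_sub
      (fun x _ => hUd x) (hU'.continuous.intervalIntegrable _ _), ← hUu ht, ← hUu h0, hu0, sub_zero]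

end Hadamard

/-! ### Zeros with multiplicity, and their behaviour under sums and products. -/

section Jets

variable {S : Set ℝ}

/-- `u` vanishes at `t` together with its derivatives of order `< m` relative to `S`. -/
def VanishesTo (S : Set ℝ) (m : ℕ) (u : ℝ → ℂ) (t : ℝ) : Prop :=
  ∀ j < m, iteratedDerivWithin j u S t = 0

lemma VanishesTo.mono {m m' : ℕ} {u : ℝ → ℂ} {t : ℝ} (h : VanishesTo S m u t) (hm : m' ≤ m) :
    VanishesTo S m' u t := fun j hj => h j (hj.trans_le hm)

lemma VanishesTo.congr {m : ℕ} {u v : ℝ → ℂ} {t : ℝ} (h : VanishesTo S m u t) (ht : t ∈ S)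
    (huv : EqOn v u S) : VanishesTo S m v t := fun j hj => by
  rw [iteratedDerivWithin_congr huv ht, h j hj]

lemma VanishesTo.apply_eq_zero {m : ℕ} {u : ℝ → ℂ} {t : ℝ} (h : VanishesTo S m u t) (hm : 0 < m) :
    u t = 0 := by simpa using h 0 hm

lemma VanishesTo.derivWithin {m : ℕ} {u : ℝ → ℂ} {t : ℝ}
    (h : VanishesTo S (m + 1) u t) : VanishesTo S m (derivWithin u S) t := fun j hj => by
  rw [← iteratedDerivWithin_succ', h (j + 1) (by omega)]

lemma VanishesTo.add {m : ℕ} {u v : ℝ → ℂ} {t : ℝ} (hu : VanishesTo S m u t)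
    (hv : VanishesTo S m v t) (hS : UniqueDiffOn ℝ S) (ht : t ∈ S) {k : ℕ} (hk : m ≤ k + 1)
    (hcu : ContDiffOn ℝ k u S) (hcv : ContDiffOn ℝ k v S) :
    VanishesTo S m (fun x => u x + v x) t := fun j hj => by
  have hjk : (j : WithTop ℕ∞) ≤ k := by exact_mod_cast (by omega : j ≤ k)
  rw [iteratedDerivWithin_fun_add ht hS ((hcu t ht).of_le hjk) ((hcv t ht).of_le hjk),
    hu j hj, hv j hj, add_zero]

lemma VanishesTo.mul_left {m : ℕ} {u v : ℝ → ℂ} {t : ℝ}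
    (hv : VanishesTo S m v t) (hS : UniqueDiffOn ℝ S) (ht : t ∈ S) {k : ℕ} (hk : m ≤ k + 1)
    (hcu : ContDiffOn ℝ k u S) (hcv : ContDiffOn ℝ k v S) :
    VanishesTo S m (fun x => u x * v x) t := fun j hj => by
  have hjk : (j : WithTop ℕ∞) ≤ k := by exact_mod_cast (by omega : j ≤ k)
  have := iteratedDerivWithin_mul ht hS ((hcu t ht).of_le hjk) ((hcv t ht).of_le hjk)
  rw [show (fun x => u x * v x) = u * v from rfl, this]
  refine Finset.sum_eq_zero fun i hi => ?_
  rw [hv (j - i) (by omega), mul_zero]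

/-- A product vanishing to order `m + p`, whose first factor has a zero of order exactly `p`. -/
lemma VanishesTo.of_mul {m p : ℕ} {u v : ℝ → ℂ} {t : ℝ} (hS : UniqueDiffOn ℝ S) (ht : t ∈ S)
    {k : ℕ} (hk : m + p ≤ k + 1) (hcu : ContDiffOn ℝ k u S) (hcv : ContDiffOn ℝ k v S)
    (hu : VanishesTo S p u t) (hup : iteratedDerivWithin p u S t ≠ 0)
    (h : VanishesTo S (m + p) (fun x => u x * v x) t) : VanishesTo S m v t := by
  intro j
  induction j using Nat.strong_induction_on with
  | _ j ih =>
    intro hj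
    have hjk : ((j + p : ℕ) : WithTop ℕ∞) ≤ k := by exact_mod_cast (by omega : j + p ≤ k)
    -- In the Leibniz sum of order `j + p`, terms with `i < p` vanish by `hu` and those with `i > p`
    -- by induction; only `i = p` survives.
    have h1 := h (j + p) (by omega)
    rw [show (fun x => u x * v x) = u * v from rfl,
      iteratedDerivWithin_mul ht hS ((hcu t ht).of_le hjk) ((hcv t ht).of_le hjk),
      Finset.sum_eq_single p] at h1
    · have hc : ((j + p).choose p : ℂ) ≠ 0 := by
        exact_mod_cast (Nat.choose_pos (by omega)).ne'
      rw [Nat.add_sub_cancel] at h1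
      simpa [hc, hup] using h1
    · intro i hi hip
      rcases lt_or_gt_of_ne hip with hlt | hgt
      · rw [hu i hlt]; ring
      · rw [ih (j + p - i) (by simp at hi; omega) (by simp at hi; omega)]; ring
    · intro hp
      simp at hp

end Jets

/-! ### Phase functions and the singular weight g^α. -/

/-- `g` is a phase function on `[0, a]` of class `C^(r+1)`, with its only zero at `0` and no
stationary points. -/
structure IsPhase (a : ℝ) (r : ℕ) (g : ℝ → ℝ) : Prop where
  pos : 0 < a
  contDiffOn : ContDiffOn ℝ (r + 1 : ℕ) g (Icc 0 a)
  zero : g 0 = 0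
  deriv_pos : ∀ t ∈ Icc 0 a, 0 < derivWithin g (Icc 0 a) t

namespace IsPhase

variable {a : ℝ} {r : ℕ} {g : ℝ → ℝ}

lemma uniqueDiffOn (hg : IsPhase a r g) : UniqueDiffOn ℝ (Icc 0 a) := uniqueDiffOn_Icc hg.pos

lemma zero_mem (hg : IsPhase a r g) : (0 : ℝ) ∈ Icc 0 a := ⟨le_rfl, hg.pos.le⟩

lemma end_mem (hg : IsPhase a r g) : a ∈ Icc 0 a := ⟨hg.pos.le, le_rfl⟩

lemma contDiffOn_deriv (hg : IsPhase a r g) :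
    ContDiffOn ℝ r (derivWithin g (Icc 0 a)) (Icc 0 a) :=
  hg.contDiffOn.derivWithin hg.uniqueDiffOn (by norm_cast)

lemma hasDerivAt (hg : IsPhase a r g) {t : ℝ} (ht : t ∈ Ioo 0 a) :
    HasDerivAt g (derivWithin g (Icc 0 a) t) t :=
  ((hg.contDiffOn.differentiableOn (by simp)) t
    (Ioo_subset_Icc_self ht)).hasDerivWithinAt.hasDerivAt (Icc_mem_nhds ht.1 ht.2)

lemma strictMonoOn (hg : IsPhase a r g) : StrictMonoOn g (Icc 0 a) := by
  refine strictMonoOn_of_deriv_pos (convex_Icc 0 a) hg.contDiffOn.continuousOn fun t ht => ?_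
  rw [interior_Icc] at ht
  rw [(hg.hasDerivAt ht).deriv]
  exact hg.deriv_pos t (Ioo_subset_Icc_self ht)

lemma pos_of_mem (hg : IsPhase a r g) {t : ℝ} (ht : t ∈ Ioc 0 a) : 0 < g t := by
  have := hg.strictMonoOn hg.zero_mem (Ioc_subset_Icc_self ht) ht.1
  rwa [hg.zero] at this

lemma nonneg_of_mem (hg : IsPhase a r g) {t : ℝ} (ht : t ∈ Icc 0 a) : 0 ≤ g t := by
  have := hg.strictMonoOn.monotoneOn hg.zero_mem ht ht.1
  rwa [hg.zero] at this

lemma mem_of_mem (hg : IsPhase a r g) {t : ℝ} (ht : t ∈ Icc 0 a) : g t ∈ Icc 0 (g a) :=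
  ⟨hg.nonneg_of_mem ht, hg.strictMonoOn.monotoneOn ht hg.end_mem ht.2⟩

lemma contDiffOn_ofReal (hg : IsPhase a r g) :
    ContDiffOn ℝ (r + 1 : ℕ) (fun t => (g t : ℂ)) (Icc 0 a) :=
  Complex.ofRealCLM.contDiff.comp_contDiffOn hg.contDiffOn

lemma contDiffOn_deriv_ofReal (hg : IsPhase a r g) :
    ContDiffOn ℝ r (fun t => ((derivWithin g (Icc 0 a) t : ℝ) : ℂ)) (Icc 0 a) :=
  Complex.ofRealCLM.contDiff.comp_contDiffOn hg.contDiffOn_deriv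

lemma derivWithin_ofReal (hg : IsPhase a r g) {t : ℝ} (ht : t ∈ Icc 0 a) :
    derivWithin (fun t => (g t : ℂ)) (Icc 0 a) t = ((derivWithin g (Icc 0 a) t : ℝ) : ℂ) :=
  (((hg.contDiffOn.differentiableOn (by simp)) t ht).hasDerivWithinAt.ofReal_comp).derivWithin
    (hg.uniqueDiffOn t ht)

lemma deriv_ofReal_ne_zero (hg : IsPhase a r g) {t : ℝ} (ht : t ∈ Icc 0 a) :
    ((derivWithin g (Icc 0 a) t : ℝ) : ℂ) ≠ 0 :=
  Complex.ofReal_ne_zero.2 (hg.deriv_pos t ht).ne'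

/-- Factors the zero of g out, so that g^α is t^α times a positive C^r function. Positivity of G at
0 is g'(0) > 0. -/
lemma exists_eq_id_mul (hg : IsPhase a r g) : ∃ G : ℝ → ℝ, ContDiffOn ℝ r G (Icc 0 a) ∧
    G 0 = derivWithin g (Icc 0 a) 0 ∧ (∀ t ∈ Icc 0 a, 0 < G t) ∧
    ∀ t ∈ Icc 0 a, g t = t * G t := by
  obtain ⟨G, hG, hG0, hGg⟩ := exists_eq_id_smul hg.pos hg.contDiffOn hg.zero
  refine ⟨G, hG, hG0, fun t ht => ?_, hGg⟩
  rcases ht.1.eq_or_lt with rfl | h0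
  · rw [hG0]; exact hg.deriv_pos _ ht
  · have := hg.pos_of_mem ⟨h0, ht.2⟩
    rw [hGg t ht, smul_eq_mul] at this
    exact (mul_pos_iff_of_pos_left h0).1 this

/-- A function vanishing at `0` is divisible by `g`, with the loss of one derivative. -/
lemma exists_eq_mul (hg : IsPhase a r g) {k : ℕ} (hk : k ≤ r) {u : ℝ → ℂ}
    (hu : ContDiffOn ℝ (k + 1 : ℕ) u (Icc 0 a)) (hu0 : u 0 = 0) :
    ∃ v : ℝ → ℂ, ContDiffOn ℝ k v (Icc 0 a) ∧ ∀ t ∈ Icc 0 a, u t = (g t : ℂ) * v t := by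
  obtain ⟨G, hG, -, hGpos, hGg⟩ := hg.exists_eq_id_mul
  obtain ⟨v, hv, -, hvu⟩ := exists_eq_id_smul hg.pos hu hu0
  refine ⟨fun t => (G t)⁻¹ • v t, ?_, fun t ht => ?_⟩
  · exact ((hG.of_le (by exact_mod_cast hk)).inv fun t ht => (hGpos t ht).ne').smul hv
  · have : (G t : ℂ) ≠ 0 := Complex.ofReal_ne_zero.2 (hGpos t ht).ne'
    rw [hvu t ht, hGg t ht]
    simp only [Complex.real_smul, Complex.ofReal_mul, Complex.ofReal_inv]
    field_simp

/-- On the interval f₁ = f · (1/G)^α, and the prescribed value at 0 is the one this formula gives.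
-/
lemma contDiffOn_rhs (hg : IsPhase a r g) (α : ℝ) {f : ℝ → ℂ} (hf : ContDiffOn ℝ r f (Icc 0 a)) :
    ContDiffOn ℝ r (rhs a α f g) (Icc 0 a) := by
  obtain ⟨G, hG, hG0, hGpos, hGg⟩ := hg.exists_eq_id_mul
  have h1 : ContDiffOn ℝ r (fun t => f t * (((G t)⁻¹ ^ α : ℝ) : ℂ)) (Icc 0 a) := by
    refine hf.mul (Complex.ofRealCLM.contDiff.comp_contDiffOn ?_)
    exact (hG.inv fun t ht => (hGpos t ht).ne').rpow_const_of_ne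
      fun t ht => (inv_pos.2 (hGpos t ht)).ne'
  refine h1.congr fun t ht => ?_
  rcases ht.1.eq_or_lt with rfl | h0
  · rw [rhs, if_pos rfl, ← hG0, Real.inv_rpow (hGpos _ ht).le, div_eq_mul_inv, Complex.ofReal_inv]
  · rw [rhs, if_neg h0.ne', hGg t ht, div_mul_cancel_left₀ h0.ne']

lemma rhs_mul_rpow (hg : IsPhase a r g) (α : ℝ) (f : ℝ → ℂ) {t : ℝ} (ht : t ∈ Ioc 0 a) :
    rhs a α f g t * ((g t ^ α : ℝ) : ℂ) = f t * ((t ^ α : ℝ) : ℂ) := by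
  have hgt := hg.pos_of_mem ht
  rw [rhs, if_neg ht.1.ne', mul_assoc, ← Complex.ofReal_mul,
    ← Real.mul_rpow (div_nonneg ht.1.le hgt.le) hgt.le, div_mul_cancel₀ _ hgt.ne']

lemma intervalIntegrable_mul_rpow (hg : IsPhase a r g) {α : ℝ} (hα : -1 < α) {u : ℝ → ℂ}
    (hu : ContinuousOn u (Icc 0 a)) :
    IntervalIntegrable (fun t => u t * ((g t ^ α : ℝ) : ℂ)) MeasureTheory.volume 0 a := by
  obtain ⟨G, hG, -, hGpos, hGg⟩ := hg.exists_eq_id_mul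
  have h1 : IntervalIntegrable (fun t : ℝ => ((t ^ α : ℝ) : ℂ)) MeasureTheory.volume 0 a :=
    have h0 : IntervalIntegrable (fun t : ℝ => t ^ α) MeasureTheory.volume 0 a :=
      intervalIntegral.intervalIntegrable_rpow' hα
    ⟨h0.1.ofReal, h0.2.ofReal⟩
  have h2 : ContinuousOn (fun t => u t * ((G t ^ α : ℝ) : ℂ)) (uIcc 0 a) := by
    rw [uIcc_of_le hg.pos.le]
    exact hu.mul (Complex.continuous_ofReal.comp_continuousOn
      (hG.continuousOn.rpow_const fun t ht => Or.inl (hGpos t ht).ne'))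
  refine (h1.mul_continuousOn h2).congr fun t ht => ?_
  rw [uIoc_of_le hg.pos.le] at ht
  have ht' := Ioc_subset_Icc_self ht
  simp only [hGg t ht', Real.mul_rpow ht.1.le (hGpos t ht').le, Complex.ofReal_mul]
  ring

lemma continuousOn_rpow (hg : IsPhase a r g) {β : ℝ} (hβ : 0 < β) :
    ContinuousOn (fun t => ((g t ^ β : ℝ) : ℂ)) (Icc 0 a) :=
  Complex.continuous_ofReal.comp_continuousOn
    (hg.contDiffOn.continuousOn.rpow_const fun _ _ => Or.inr hβ.le)

lemma hasDerivAt_rpow (hg : IsPhase a r g) (β : ℝ) {t : ℝ} (ht : t ∈ Ioo 0 a) :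
    HasDerivAt (fun t => ((g t ^ β : ℝ) : ℂ))
      ((β : ℂ) * ((g t ^ (β - 1) : ℝ) : ℂ) * ((derivWithin g (Icc 0 a) t : ℝ) : ℂ)) t := by
  have h := ((hg.hasDerivAt ht).rpow_const (p := β)
    (Or.inl (hg.pos_of_mem (Ioo_subset_Ioc_self ht)).ne')).ofReal_comp
  convert h using 1
  push_cast
  ring

lemma hasDerivAt_cexp (hg : IsPhase a r g) (c : ℂ) {t : ℝ} (ht : t ∈ Ioo 0 a) :
    HasDerivAt (fun t => Complex.exp (c * (g t : ℂ)))
      (Complex.exp (c * (g t : ℂ)) * (c * ((derivWithin g (Icc 0 a) t : ℝ) : ℂ))) t :=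
  (((hg.hasDerivAt ht).ofReal_comp).const_mul c).cexp

lemma continuousOn_cexp (hg : IsPhase a r g) (c : ℂ) :
    ContinuousOn (fun t => Complex.exp (c * (g t : ℂ))) (Icc 0 a) :=
  (continuousOn_const.mul hg.contDiffOn_ofReal.continuousOn).cexp

end IsPhase

lemma hasDerivAt_of_contDiffOn {a : ℝ} {k : ℕ} {u : ℝ → ℂ}
    (hu : ContDiffOn ℝ (k + 1 : ℕ) u (Icc 0 a)) {t : ℝ} (ht : t ∈ Ioo 0 a) :
    HasDerivAt u (derivWithin u (Icc 0 a) t) t :=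
  ((hu.differentiableOn (by simp)) t
    (Ioo_subset_Icc_self ht)).hasDerivWithinAt.hasDerivAt (Icc_mem_nhds ht.1 ht.2)

/-! ### The model integral of u^α e^{iwu}. -/

/-- The primitive, vanishing at `0`, of `u ^ α * exp (i w u)`. -/
def powExpIntegral (α w y : ℝ) : ℂ :=
  ∫ u in (0 : ℝ)..y, ((u ^ α : ℝ) : ℂ) * Complex.exp (Complex.I * (w : ℂ) * (u : ℂ))

lemma norm_exp_I_mul_mul (w u : ℝ) :
    ‖Complex.exp (Complex.I * (w : ℂ) * (u : ℂ))‖ = 1 := by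
  rw [show Complex.I * (w : ℂ) * (u : ℂ) = ((w * u : ℝ) : ℂ) * Complex.I by push_cast; ring,
    Complex.norm_exp_ofReal_mul_I]

lemma intervalIntegrable_rpow_mul_exp {α : ℝ} {y z : ℝ} (w : ℝ) (hα : -1 < α ∨ (0 : ℝ) ∉ uIcc y z) :
    IntervalIntegrable (fun u : ℝ => ((u ^ α : ℝ) : ℂ)
      * Complex.exp (Complex.I * (w : ℂ) * (u : ℂ))) MeasureTheory.volume y z := by
  have h0 : IntervalIntegrable (fun t : ℝ => t ^ α) MeasureTheory.volume y z := by
    rcases hα with hα | hα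
    · exact intervalIntegral.intervalIntegrable_rpow' hα
    · exact intervalIntegral.intervalIntegrable_rpow (Or.inr hα)
  have h1 : IntervalIntegrable (fun t : ℝ => ((t ^ α : ℝ) : ℂ)) MeasureTheory.volume y z :=
    ⟨h0.1.ofReal, h0.2.ofReal⟩
  exact h1.mul_continuousOn (by fun_prop)

lemma continuous_powExpIntegral {α : ℝ} (hα : -1 < α) (w : ℝ) :
    Continuous (powExpIntegral α w) :=
  intervalIntegral.continuous_primitive
    (fun _ _ => intervalIntegrable_rpow_mul_exp w (Or.inl hα)) 0

lemma hasDerivAt_powExpIntegral {α : ℝ} (hα : -1 < α) (w : ℝ) {y : ℝ} (hy : 0 < y) :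
    HasDerivAt (powExpIntegral α w)
      (((y ^ α : ℝ) : ℂ) * Complex.exp (Complex.I * (w : ℂ) * (y : ℂ))) y := by
  have hc : ContinuousOn (fun u : ℝ => ((u ^ α : ℝ) : ℂ)
      * Complex.exp (Complex.I * (w : ℂ) * (u : ℂ))) (Ioi 0) := by
    refine (Complex.continuous_ofReal.comp_continuousOn
      (continuousOn_id.rpow_const fun t ht => Or.inl (ne_of_gt ht))).mul (by fun_prop)
  exact intervalIntegral.integral_hasDerivAt_right
    (intervalIntegrable_rpow_mul_exp w (Or.inl hα))
    (hc.stronglyMeasurableAtFilter isOpen_Ioi y hy)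
    (hc.continuousAt (Ioi_mem_nhds hy))

/-- Integration by parts: the boundary terms cost y^α + z^α, and since u^α is monotone its variation
is |z^α - y^α|; the sum is twice the maximum. The last hypothesis makes u^(α-1) integrable. -/
lemma norm_integral_rpow_mul_exp_le {α : ℝ} (hα0 : α ≠ 0) {w : ℝ} (hw : w ≠ 0) {y z : ℝ}
    (hy : 0 ≤ y) (hyz : y ≤ z) (h : 0 < y ∨ 0 < α) :
    ‖∫ u in y..z, ((u ^ α : ℝ) : ℂ) * Complex.exp (Complex.I * (w : ℂ) * (u : ℂ))‖
      ≤ 2 * max (y ^ α) (z ^ α) / |w| := by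
  have hsub : ∀ β : ℝ, 0 < y ∨ 0 < β + 1 → -1 < β ∨ (0 : ℝ) ∉ uIcc y z := fun β hβ => by
    rcases hβ with hβ | hβ
    · right; rw [uIcc_of_le hyz]; exact fun h => absurd h.1 (not_le.2 hβ)
    · left; linarith
  have hi1 := intervalIntegrable_rpow_mul_exp w (hsub α (h.imp_right fun h => by linarith))
  have hi2 := intervalIntegrable_rpow_mul_exp w (hsub (α - 1) (h.imp_right fun h => by linarith))
  have hftc := intervalIntegral.integral_eq_sub_of_hasDerivAt_of_le hyz
    (f := fun u : ℝ => ((u ^ α : ℝ) : ℂ) * Complex.exp (Complex.I * (w : ℂ) * (u : ℂ)))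
    (f' := fun u : ℝ => (α : ℂ) * (((u ^ (α - 1) : ℝ) : ℂ)
        * Complex.exp (Complex.I * (w : ℂ) * (u : ℂ)))
      + Complex.I * (w : ℂ) * (((u ^ α : ℝ) : ℂ)
        * Complex.exp (Complex.I * (w : ℂ) * (u : ℂ)))) ?_ ?_
    ((hi2.const_mul _).add (hi1.const_mul _))
  · rw [intervalIntegral.integral_add (hi2.const_mul _) (hi1.const_mul _),
      intervalIntegral.integral_const_mul, intervalIntegral.integral_const_mul] at hftc
    set A := ∫ u in y..z, ((u ^ α : ℝ) : ℂ) * Complex.exp (Complex.I * (w : ℂ) * (u : ℂ))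
    have hB : ‖(α : ℂ) * ∫ u in y..z, ((u ^ (α - 1) : ℝ) : ℂ)
        * Complex.exp (Complex.I * (w : ℂ) * (u : ℂ))‖ ≤ |z ^ α - y ^ α| := by
      have h1 : ‖∫ u in y..z, ((u ^ (α - 1) : ℝ) : ℂ)
          * Complex.exp (Complex.I * (w : ℂ) * (u : ℂ))‖ ≤ ∫ u in y..z, u ^ (α - 1) := by
        refine (intervalIntegral.norm_integral_le_integral_norm hyz).trans (le_of_eq ?_)
        refine intervalIntegral.integral_congr fun u hu => ?_
        rw [uIcc_of_le hyz] at hu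
        simp only [norm_mul, norm_exp_I_mul_mul, mul_one, Complex.norm_real]
        exact Real.norm_of_nonneg (Real.rpow_nonneg (hy.trans hu.1) _)
      have h2 : ∫ u in y..z, u ^ (α - 1) = (z ^ α - y ^ α) / α := by
        rw [integral_rpow, sub_add_cancel]
        rcases hsub (α - 1) (h.imp_right fun h => by linarith) with h3 | h3
        · exact Or.inl h3
        · exact Or.inr ⟨fun h4 => hα0 (by linarith), h3⟩
      rw [norm_mul, Complex.norm_real, Real.norm_eq_abs]
      calc |α| * _ ≤ |α| * |(z ^ α - y ^ α) / α| := by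
            gcongr; exact h1.trans (h2 ▸ le_abs_self _)
        _ = |z ^ α - y ^ α| := by rw [abs_div, mul_div_cancel₀ _ (abs_ne_zero.2 hα0)]
    have hA : ‖Complex.I * (w : ℂ) * A‖ ≤ 2 * max (y ^ α) (z ^ α) := by
      rw [← eq_sub_iff_add_eq'] at hftc
      rw [hftc]
      have hz0 := Real.rpow_nonneg (hy.trans hyz) α
      have hy0 := Real.rpow_nonneg hy α
      refine (?_ : _ ≤ z ^ α + y ^ α + |z ^ α - y ^ α|).trans ?_
      · refine (norm_sub_le _ _).trans (add_le_add ((norm_sub_le _ _).trans_eq ?_) hB)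
        simp only [norm_mul, norm_exp_I_mul_mul, mul_one, Complex.norm_real,
          Real.norm_of_nonneg hz0, Real.norm_of_nonneg hy0]
      · rcases le_total (y ^ α) (z ^ α) with h4 | h4
        · rw [abs_of_nonneg (by linarith), max_eq_right h4]; linarith
        · rw [abs_of_nonpos (by linarith), max_eq_left h4]; linarith
    rw [norm_mul, norm_mul, Complex.norm_I, one_mul, Complex.norm_real, Real.norm_eq_abs] at hA
    rw [le_div_iff₀ (abs_pos.2 hw)]
    linarith
  · refine (Complex.continuous_ofReal.comp_continuousOn
      (continuousOn_id.rpow_const fun t ht => ?_)).mul (by fun_prop)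
    exact h.imp (fun h => (h.trans_le ht.1).ne') le_of_lt
  · intro u hu
    have hu0 : u ≠ 0 := (hy.trans_lt hu.1).ne'
    have h1 := (Real.hasDerivAt_rpow_const (p := α) (Or.inl hu0)).ofReal_comp
    have h2 := (((hasDerivAt_id u).ofReal_comp).const_mul (Complex.I * (w : ℂ))).cexp
    refine (h1.mul h2).congr_deriv ?_
    simp only [id, Complex.ofReal_mul, Complex.ofReal_one]
    ring

/-- For α < 0, split at 1/|w|: the trivial bound below, integration by parts above, both of size
|w|^(-(1+α)). For α > 0, integration by parts works from 0. -/
lemma exists_norm_powExpIntegral_le {α : ℝ} (hα0 : α ≠ 0) (hα : -1 < α) (b : ℝ) :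
    ∃ C, ∀ w : ℝ, 1 ≤ |w| → ∀ y ∈ Icc 0 b,
      ‖powExpIntegral α w y‖ ≤ C * |w| ^ (-min (1 + α) 1) := by
  rcases hα0.lt_or_gt with hneg | hpos
  · refine ⟨1 / (1 + α) + 2, fun w hw y hy => ?_⟩
    have hw0 : 0 < |w| := one_pos.trans_le hw
    have hmain : ∀ δ, 0 ≤ δ → δ ≤ |w|⁻¹ →
        ‖powExpIntegral α w δ‖ ≤ 1 / (1 + α) * |w| ^ (-(1 + α)) := by
      intro δ hδ hδw
      have h1 : ‖powExpIntegral α w δ‖ ≤ ∫ u in (0 : ℝ)..δ, u ^ α := by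
        refine (intervalIntegral.norm_integral_le_integral_norm hδ).trans (le_of_eq ?_)
        refine intervalIntegral.integral_congr fun u hu => ?_
        rw [uIcc_of_le hδ] at hu
        simp only [norm_mul, norm_exp_I_mul_mul, mul_one, Complex.norm_real]
        exact Real.norm_of_nonneg (Real.rpow_nonneg hu.1 _)
      rw [integral_rpow (Or.inl hα), Real.zero_rpow (by linarith), sub_zero, add_comm α 1] at h1
      rw [Real.rpow_neg hw0.le, ← Real.inv_rpow hw0.le]
      refine h1.trans ?_
      rw [div_eq_inv_mul, one_div]
      gcongr
      · exact inv_nonneg.2 (by linarith)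
      · linarith
    rw [min_eq_left (by linarith), add_mul]
    rcases le_total y |w|⁻¹ with hyw | hyw
    · exact (hmain y hy.1 hyw).trans (le_add_of_nonneg_right (by positivity))
    · have hw' : w ≠ 0 := abs_pos.1 hw0
      have hδ : 0 < |w|⁻¹ := inv_pos.2 hw0
      have hsplit : powExpIntegral α w y = powExpIntegral α w |w|⁻¹
          + ∫ u in |w|⁻¹..y, ((u ^ α : ℝ) : ℂ) * Complex.exp (Complex.I * (w : ℂ) * (u : ℂ)) :=
        (intervalIntegral.integral_add_adjacent_intervals
          (intervalIntegrable_rpow_mul_exp w (Or.inl hα))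
          (intervalIntegrable_rpow_mul_exp w (Or.inl hα))).symm
      rw [hsplit]
      refine (norm_add_le _ _).trans (add_le_add (hmain _ hδ.le le_rfl) ?_)
      refine (norm_integral_rpow_mul_exp_le hα0 hw' hδ.le hyw (Or.inl hδ)).trans (le_of_eq ?_)
      rw [max_eq_left (Real.rpow_le_rpow_of_nonpos hδ hyw hneg.le), Real.inv_rpow hw0.le,
        neg_add, Real.rpow_add hw0, Real.rpow_neg_one, Real.rpow_neg hw0.le]
      field_simp
  · rcases lt_or_ge b 0 with hb | hb
    · exact ⟨0, fun w _ y hy => absurd (hy.1.trans hy.2) (not_le.2 hb)⟩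
    · refine ⟨2 * b ^ α, fun w hw y hy => ?_⟩
      have hw0 : 0 < |w| := one_pos.trans_le hw
      refine (norm_integral_rpow_mul_exp_le hα0 (abs_pos.1 hw0) le_rfl hy.1 (Or.inr hpos)).trans ?_
      rw [min_eq_right (by linarith), Real.rpow_neg_one, Real.zero_rpow hα0, ← div_eq_mul_inv,
        max_eq_right (Real.rpow_nonneg hy.1 _)]
      gcongr
      exacts [hy.1, hy.2]

/-! ### Decay of oscillatory integrals with end-point zeros. -/

/-- The oscillatory integral of `u * g ^ α * exp (i w g)` over `[0, a]`. -/
def weightedOsc (a α w : ℝ) (g : ℝ → ℝ) (u : ℝ → ℂ) : ℂ :=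
  ∫ t in (0 : ℝ)..a, u t * Complex.exp (Complex.I * (w : ℂ) * (g t : ℂ)) * ((g t ^ α : ℝ) : ℂ)

namespace IsPhase

variable {a α : ℝ} {r : ℕ} {g : ℝ → ℝ}

lemma intervalIntegrable_osc (hg : IsPhase a r g) (hα : -1 < α) (w : ℝ) {u : ℝ → ℂ}
    (hu : ContinuousOn u (Icc 0 a)) :
    IntervalIntegrable (fun t => u t * Complex.exp (Complex.I * (w : ℂ) * (g t : ℂ))
      * ((g t ^ α : ℝ) : ℂ)) MeasureTheory.volume 0 a :=
  hg.intervalIntegrable_mul_rpow hα (hu.mul (hg.continuousOn_cexp _))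

/-- The decay of the oscillatory integral, without any vanishing at the end points. -/
lemma exists_norm_weightedOsc_le_of_contDiffOn_one (hg : IsPhase a r g) (hα0 : α ≠ 0)
    (hα : -1 < α) {e : ℝ → ℂ} (he : ContDiffOn ℝ 1 e (Icc 0 a)) :
    ∃ C, ∀ w : ℝ, 1 ≤ |w| →
      ‖weightedOsc a α w g fun t => ((derivWithin g (Icc 0 a) t : ℝ) : ℂ) * e t‖
        ≤ C * |w| ^ (-min (1 + α) 1) := by
  -- Integrate by parts against J ∘ g, where J is `powExpIntegral`: its derivative is g' g^α
  -- e^{iwg}, it is uniformly small, and it vanishes at 0.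
  obtain ⟨K, hK⟩ := exists_norm_powExpIntegral_le hα0 hα (g a)
  have he' : ContinuousOn (derivWithin e (Icc 0 a)) (Icc 0 a) :=
    he.continuousOn_derivWithin hg.uniqueDiffOn le_rfl
  obtain ⟨B, hB⟩ := isCompact_Icc.exists_bound_of_continuousOn he'
  refine ⟨(‖e a‖ + B * a) * K, fun w hw => ?_⟩
  have hJ : ContinuousOn (fun t => powExpIntegral α w (g t)) (Icc 0 a) :=
    (continuous_powExpIntegral hα w).comp_continuousOn hg.contDiffOn.continuousOn
  have hi1 : IntervalIntegrable (fun t => derivWithin e (Icc 0 a) t * powExpIntegral α w (g t))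
      MeasureTheory.volume 0 a :=
    ((he'.mul hJ).mono (by rw [uIcc_of_le hg.pos.le])).intervalIntegrable
  have hi2 := hg.intervalIntegrable_osc hα w
    (hg.contDiffOn_deriv_ofReal.continuousOn.mul he.continuousOn)
  have hftc := intervalIntegral.integral_eq_sub_of_hasDerivAt_of_le hg.pos.le
    (he.continuousOn.mul hJ) (fun t ht => ?_) (hi1.add hi2)
  · rw [intervalIntegral.integral_add hi1 hi2] at hftc
    change _ + weightedOsc a α w g (fun t => ((derivWithin g (Icc 0 a) t : ℝ) : ℂ) * e t) =
      e a * powExpIntegral α w (g a) - e 0 * powExpIntegral α w (g 0) at hftc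
    rw [hg.zero, show powExpIntegral α w 0 = 0 from intervalIntegral.integral_same, mul_zero,
      sub_zero, ← eq_sub_iff_add_eq'] at hftc
    rw [hftc]
    refine (norm_sub_le _ _).trans ?_
    rw [add_mul, add_mul, mul_assoc, mul_assoc]
    refine add_le_add ?_ ?_
    · rw [norm_mul]
      gcongr
      exact hK w hw _ (hg.mem_of_mem hg.end_mem)
    · refine (intervalIntegral.norm_integral_le_of_norm_le_const
        (C := B * (K * |w| ^ (-min (1 + α) 1))) fun t ht => ?_).trans (le_of_eq ?_)
      · rw [uIoc_of_le hg.pos.le] at ht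
        have ht' := Ioc_subset_Icc_self ht
        rw [norm_mul]
        exact mul_le_mul (hB t ht') (hK w hw _ (hg.mem_of_mem ht')) (norm_nonneg _)
          ((norm_nonneg _).trans (hB t ht'))
      · rw [sub_zero, abs_of_pos hg.pos]; ring
  · have hgt := hg.pos_of_mem (Ioo_subset_Ioc_self ht)
    have h1 := (hasDerivAt_powExpIntegral hα w hgt).scomp t (hg.hasDerivAt ht)
    have h2 := hasDerivAt_of_contDiffOn (k := 0) (by exact_mod_cast he) ht
    refine (h2.mul h1).congr_deriv ?_
    simp only [Function.comp_apply, Complex.real_smul, Pi.mul_apply]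
    ring

/-- One integration by parts: the amplitude `e = g * v` is replaced by `e' / g' + α v`. -/
lemma weightedOsc_eq_of_eq_mul (hg : IsPhase a r g) (hα : -1 < α) {k : ℕ} {e v : ℝ → ℂ}
    (he : ContDiffOn ℝ (k + 1 : ℕ) e (Icc 0 a)) (hv : ContinuousOn v (Icc 0 a))
    (hev : ∀ t ∈ Icc 0 a, e t = (g t : ℂ) * v t) (hea : e a = 0) (w : ℝ) :
    Complex.I * (w : ℂ) *
        (weightedOsc a α w g fun t => ((derivWithin g (Icc 0 a) t : ℝ) : ℂ) * e t)
      = -weightedOsc a α w g fun t => ((derivWithin g (Icc 0 a) t : ℝ) : ℂ) *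
          (((derivWithin g (Icc 0 a) t : ℝ) : ℂ)⁻¹ * derivWithin e (Icc 0 a) t + α * v t) := by
  have he' : ContinuousOn (derivWithin e (Icc 0 a)) (Icc 0 a) :=
    he.continuousOn_derivWithin hg.uniqueDiffOn (by exact_mod_cast (by omega : 1 ≤ k + 1))
  have hgc := hg.contDiffOn_deriv_ofReal.continuousOn
  have hi1 := (hg.intervalIntegrable_osc hα w (hgc.mul he.continuousOn)).const_mul
    (Complex.I * (w : ℂ))
  have hi2 := hg.intervalIntegrable_osc hα w
    (hgc.mul (((hgc.inv₀ fun t ht => hg.deriv_ofReal_ne_zero ht).mul he').add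
      (hv.const_smul (α : ℂ))))
  have he0 : e 0 = 0 := by rw [hev 0 hg.zero_mem, hg.zero]; simp
  have hftc := intervalIntegral.integral_eq_sub_of_hasDerivAt_of_le hg.pos.le
    (f := fun t => e t * Complex.exp (Complex.I * (w : ℂ) * (g t : ℂ)) * ((g t ^ α : ℝ) : ℂ))
    ?_ (fun t ht => ?_) (hi1.add hi2)
  · rw [intervalIntegral.integral_add hi1 hi2, intervalIntegral.integral_const_mul, hea, he0] at hftc
    simp only [zero_mul, sub_zero] at hftc
    exact eq_neg_of_add_eq_zero_left hftc
  -- Continuity at 0 despite the factor g^α: e g^α = v g^(1+α) and 1 + α > 0.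
  · refine ((hv.mul (hg.continuousOn_cexp (Complex.I * (w : ℂ)))).mul
      (hg.continuousOn_rpow (β := 1 + α) (by linarith))).congr fun t ht => ?_
    simp only [Pi.mul_apply]
    rcases ht.1.eq_or_lt with rfl | h0
    · rw [he0, hg.zero, Real.zero_rpow (by linarith : 1 + α ≠ 0)]; simp
    · rw [Real.rpow_add (hg.pos_of_mem ⟨h0, ht.2⟩), Real.rpow_one, hev t ht, Complex.ofReal_mul]
      ring
  · have hgt := hg.pos_of_mem (Ioo_subset_Ioc_self ht)
    have ht' := Ioo_subset_Icc_self ht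
    have hg0 := hg.deriv_ofReal_ne_zero ht'
    refine (((hasDerivAt_of_contDiffOn he ht).mul (hg.hasDerivAt_cexp (Complex.I * (w : ℂ)) ht)).mul
      (hg.hasDerivAt_rpow α ht)).congr_deriv ?_
    have h1 : ((g t ^ α : ℝ) : ℂ) = (g t : ℂ) * ((g t ^ (α - 1) : ℝ) : ℂ) := by
      rw [← Complex.ofReal_mul, mul_comm, ← Real.rpow_add_one hgt.ne', sub_add_cancel]
    simp only [Pi.mul_apply, Pi.add_apply, Pi.inv_apply, Pi.smul_apply, smul_eq_mul]
    rw [h1, hev t ht']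
    field_simp
    ring

/-- The decay of the oscillatory integral for an amplitude with zeros of order `N` at both ends. -/
lemma exists_norm_weightedOsc_le (hg : IsPhase a r g) (hα0 : α ≠ 0) (hα : -1 < α) (N : ℕ) :
    N ≤ r → ∀ e : ℝ → ℂ, ContDiffOn ℝ (N + 1 : ℕ) e (Icc 0 a) →
      VanishesTo (Icc 0 a) N e 0 → VanishesTo (Icc 0 a) N e a →
      ∃ C, ∀ w : ℝ, 1 ≤ |w| →
        ‖weightedOsc a α w g fun t => ((derivWithin g (Icc 0 a) t : ℝ) : ℂ) * e t‖
          ≤ C * |w| ^ (-(N : ℝ) - min (1 + α) 1) := by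
  induction N with
  | zero =>
    intro _ e he _ _
    simpa using hg.exists_norm_weightedOsc_le_of_contDiffOn_one hα0 hα (by simpa using he)
  | succ N ih =>
    intro hN e he h0 ha
    obtain ⟨v, hv, hev⟩ := hg.exists_eq_mul hN he (h0.apply_eq_zero (by omega))
    have hle : ((N + 1 : ℕ) : WithTop ℕ∞) ≤ r := by exact_mod_cast hN
    have hgc := (hg.contDiffOn_deriv_ofReal.of_le hle).inv fun t ht => hg.deriv_ofReal_ne_zero ht
    have hgv : ContDiffOn ℝ (N + 1 : ℕ) (fun t => (g t : ℂ)) (Icc 0 a) :=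
      hg.contDiffOn_ofReal.of_le (by exact_mod_cast (by omega : N + 1 ≤ r + 1))
    have he' : ContDiffOn ℝ (N + 1 : ℕ) (derivWithin e (Icc 0 a)) (Icc 0 a) :=
      he.derivWithin hg.uniqueDiffOn (by norm_cast)
    have hαv : ContDiffOn ℝ (N + 1 : ℕ) (fun t => (α : ℂ) * v t) (Icc 0 a) :=
      contDiffOn_const.mul hv
    -- The new amplitude keeps zeros of order `N`: differentiating e costs one order.
    have hvan : ∀ t ∈ Icc 0 a, VanishesTo (Icc 0 a) (N + 1) e t → VanishesTo (Icc 0 a) N v t →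
        VanishesTo (Icc 0 a) N (fun t => ((derivWithin g (Icc 0 a) t : ℝ) : ℂ)⁻¹ *
          derivWithin e (Icc 0 a) t + α * v t) t := fun t ht h1 h2 =>
      (h1.derivWithin.mul_left hg.uniqueDiffOn ht (by omega) hgc he').add
        (h2.mul_left hg.uniqueDiffOn ht (by omega) contDiffOn_const hv) hg.uniqueDiffOn ht
        (by omega) (hgc.mul he') hαv
    -- Dividing by g costs one order at 0, its simple zero, and none at `a`, where g ≠ 0.
    have hv0 : VanishesTo (Icc 0 a) N v 0 := by
      refine VanishesTo.of_mul (p := 1) hg.uniqueDiffOn hg.zero_mem (k := N + 1) (by omega) hgv hv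
        ?_ ?_ (h0.congr hg.zero_mem fun t ht => (hev t ht).symm)
      · intro j hj
        obtain rfl : j = 0 := by omega
        simp [hg.zero]
      · rw [iteratedDerivWithin_one, hg.derivWithin_ofReal hg.zero_mem]
        exact hg.deriv_ofReal_ne_zero hg.zero_mem
    have hva : VanishesTo (Icc 0 a) N v a := by
      refine VanishesTo.of_mul (p := 0) hg.uniqueDiffOn hg.end_mem (k := N + 1) (by omega) hgv hv
        (fun j hj => absurd hj (by omega)) ?_
        ((ha.mono (by omega)).congr hg.end_mem fun t ht => (hev t ht).symm)
      rw [iteratedDerivWithin_zero]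
      exact Complex.ofReal_ne_zero.2 (hg.pos_of_mem ⟨hg.pos, le_rfl⟩).ne'
    obtain ⟨C, hC⟩ := ih (by omega) _ ((hgc.mul he').add hαv)
      (hvan 0 hg.zero_mem h0 hv0) (hvan a hg.end_mem ha hva)
    refine ⟨C, fun w hw => ?_⟩
    have hw0 : 0 < |w| := one_pos.trans_le hw
    have h1 := congrArg norm (hg.weightedOsc_eq_of_eq_mul hα he hv.continuousOn hev
      (ha.apply_eq_zero (by omega)) w)
    rw [norm_neg, norm_mul, norm_mul, Complex.norm_I, one_mul, Complex.norm_real,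
      Real.norm_eq_abs] at h1
    have h2 := h1.trans_le (hC w hw)
    rw [show (-((N + 1 : ℕ) : ℝ) - min (1 + α) 1) = (-(N : ℝ) - min (1 + α) 1) - 1 by
      push_cast; ring, Real.rpow_sub_one hw0.ne', ← mul_div_assoc, le_div_iff₀ hw0]
    linarith

end IsPhase

/-! ### The Levin rule as an exact integral. -/

namespace IsPhase

variable {a α : ℝ} {r : ℕ} {g : ℝ → ℝ}

/-- The factor g gained here compensates the singularity of g^(α-1) in the integrand of h, and of
g^α in `primitive`. -/
lemma exists_one_sub_cexp_eq (hg : IsPhase a r g) (c : ℂ) :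
    ∃ v : ℝ → ℂ, ContinuousOn v (Icc 0 a) ∧
      ∀ t ∈ Icc 0 a, 1 - Complex.exp (c * (g t : ℂ)) = (g t : ℂ) * v t := by
  obtain ⟨v, hv, hvu⟩ := hg.exists_eq_mul le_rfl (u := fun t => 1 - Complex.exp (c * (g t : ℂ)))
    (contDiffOn_const.sub (contDiffOn_const.mul hg.contDiffOn_ofReal).cexp) (by simp [hg.zero])
  exact ⟨v, hv.continuousOn, hvu⟩

/-- The integrand in the definition of `h`. -/
def hIntegrand (a α w : ℝ) (g : ℝ → ℝ) (t : ℝ) : ℂ :=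
  ((derivWithin g (Icc 0 a) t : ℝ) : ℂ) * (1 - Complex.exp (Complex.I * (w : ℂ) * (g t : ℂ)))
    / (((g t) ^ (1 - α) : ℝ) : ℂ)

lemma intervalIntegrable_hIntegrand (hg : IsPhase a r g) (hα : -1 < α) (w : ℝ) :
    IntervalIntegrable (hIntegrand a α w g) MeasureTheory.volume 0 a := by
  obtain ⟨v, hv, hvu⟩ := hg.exists_one_sub_cexp_eq (Complex.I * (w : ℂ))
  refine (hg.intervalIntegrable_mul_rpow hα
    (hg.contDiffOn_deriv_ofReal.continuousOn.mul hv)).congr fun t ht => ?_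
  rw [uIoc_of_le hg.pos.le] at ht
  have hgt := hg.pos_of_mem ht
  simp only [hIntegrand, Pi.mul_apply]
  rw [hvu t (Ioc_subset_Icc_self ht), Real.rpow_sub hgt, Real.rpow_one, Complex.ofReal_div]
  have h1 : (g t : ℂ) ≠ 0 := Complex.ofReal_ne_zero.2 hgt.ne'
  have h2 : ((g t ^ α : ℝ) : ℂ) ≠ 0 := Complex.ofReal_ne_zero.2 (Real.rpow_pos_of_pos hgt α).ne'
  field_simp

lemma continuousOn_hIntegrand (hg : IsPhase a r g) (w : ℝ) :
    ContinuousOn (hIntegrand a α w g) (Ioc 0 a) := by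
  refine ((hg.contDiffOn_deriv_ofReal.continuousOn.mul
    (continuousOn_const.sub (hg.continuousOn_cexp _))).mono Ioc_subset_Icc_self).div
    (Complex.continuous_ofReal.comp_continuousOn ((hg.contDiffOn.continuousOn.mono
      Ioc_subset_Icc_self).rpow_const fun t ht => Or.inl (hg.pos_of_mem ht).ne')) fun t ht => ?_
  exact Complex.ofReal_ne_zero.2 (Real.rpow_pos_of_pos (hg.pos_of_mem ht) _).ne'

lemma hasDerivAt_h (hg : IsPhase a r g) (hα : -1 < α) (w : ℝ) (c₀ : ℂ) {t : ℝ}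
    (ht : t ∈ Ioo 0 a) :
    HasDerivAt (h a α w g c₀)
      (-(Complex.I * (w : ℂ) * ((derivWithin g (Icc 0 a) t : ℝ) : ℂ)) * h a α w g c₀ t
        + α * c₀ * Complex.exp (-(Complex.I * (w : ℂ) * (g t : ℂ))) * hIntegrand a α w g t) t := by
  have hc : ContinuousOn (hIntegrand a α w g) (Ioo 0 a) :=
    (hg.continuousOn_hIntegrand w).mono Ioo_subset_Ioc_self
  have h1 : HasDerivAt (fun y => ∫ τ in (0 : ℝ)..y, hIntegrand a α w g τ)
      (hIntegrand a α w g t) t := by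
    refine intervalIntegral.integral_hasDerivAt_right
      ((hg.intervalIntegrable_hIntegrand hα w).mono_set ?_)
      (hc.stronglyMeasurableAtFilter isOpen_Ioo t ht) (hc.continuousAt (Ioo_mem_nhds ht.1 ht.2))
    rw [uIcc_of_le ht.1.le, uIcc_of_le hg.pos.le]
    exact Icc_subset_Icc_right ht.2.le
  have h2 := hg.hasDerivAt_cexp (-(Complex.I * (w : ℂ))) ht
  simp only [neg_mul] at h2
  refine ((h2.const_mul ((α : ℂ) * c₀)).mul h1).congr_deriv ?_
  rw [show h a α w g c₀ t = α * c₀ * Complex.exp (-(Complex.I * (w : ℂ) * (g t : ℂ)))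
    * ∫ τ in (0 : ℝ)..t, hIntegrand a α w g τ from rfl]
  ring

lemma continuousOn_h (hg : IsPhase a r g) (hα : -1 < α) (w : ℝ) (c₀ : ℂ) :
    ContinuousOn (h a α w g c₀) (Icc 0 a) := by
  have h1 : ContinuousOn (fun y => ∫ τ in (0 : ℝ)..y, hIntegrand a α w g τ) (Icc 0 a) := by
    have := intervalIntegral.continuousOn_primitive_interval
      ((intervalIntegrable_iff_integrableOn_Icc_of_le hg.pos.le).1
        (hg.intervalIntegrable_hIntegrand hα w) |>.mono_set (uIcc_of_le hg.pos.le).le)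
    rwa [uIcc_of_le hg.pos.le] at this
  have h2 := hg.continuousOn_cexp (-(Complex.I * (w : ℂ)))
  simp only [neg_mul] at h2
  exact (continuousOn_const.mul h2).mul h1

/-- The c₀ term equals a continuous function times g^(α+1), so it tends to 0 at 0 even when α < 0.
The value at 0 computed by the definition is thus the limit. -/
lemma continuousOn_primitive (hg : IsPhase a r g) (hα : -1 < α) (w : ℝ) (c₀ : ℂ) {q : ℝ → ℂ}
    (hq : ContinuousOn q (Icc 0 a)) : ContinuousOn (primitive a α w g c₀ q) (Icc 0 a) := by
  obtain ⟨v, hv, hvu⟩ := hg.exists_one_sub_cexp_eq (-(Complex.I * (w : ℂ)))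
  have hr := hg.continuousOn_rpow (β := α + 1) (by linarith)
  have h1 : ContinuousOn (fun t => c₀ * (1 - Complex.exp (-(Complex.I * (w : ℂ) * (g t : ℂ))))
      * (((g t) ^ α : ℝ) : ℂ)) (Icc 0 a) := by
    refine ((continuousOn_const (c := c₀)).mul (hv.mul hr)).congr fun t ht => ?_
    rw [← neg_mul, hvu t ht]
    rcases ht.1.eq_or_lt with rfl | h0
    · simp [hg.zero, Real.zero_rpow (by linarith : α + 1 ≠ 0)]
    · simp only [Pi.mul_apply]
      rw [Real.rpow_add (hg.pos_of_mem ⟨h0, ht.2⟩), Real.rpow_one, Complex.ofReal_mul]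
      ring
  exact (((hr.mul hq).add h1).add (hg.continuousOn_h hα w c₀)).mul (hg.continuousOn_cexp _)

/-- The derivative of h e^{iwg} is α c₀ g' (1 - e^{iwg}) g^(α-1), which removes the only term not of
the form g^α e^{iwg} times a smooth amplitude. -/
lemma hasDerivAt_primitive (hg : IsPhase a r g) (hα : -1 < α) (w : ℝ) (c₀ : ℂ) {q : ℝ → ℂ}
    {k : ℕ} (hq : ContDiffOn ℝ (k + 1 : ℕ) q (Icc 0 a)) {t : ℝ} (ht : t ∈ Ioo 0 a) :
    HasDerivAt (primitive a α w g c₀ q)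
      (W a α w g c₀ q t * Complex.exp (Complex.I * (w : ℂ) * (g t : ℂ))
        * ((g t ^ α : ℝ) : ℂ)) t := by
  have hgt := hg.pos_of_mem (Ioo_subset_Ioc_self ht)
  have he := hg.hasDerivAt_cexp (-(Complex.I * (w : ℂ))) ht
  simp only [neg_mul] at he
  have h1 := (hg.hasDerivAt_rpow (α + 1) ht).mul (hasDerivAt_of_contDiffOn hq ht)
  have h2 := ((he.const_sub 1).const_mul c₀).mul (hg.hasDerivAt_rpow α ht)
  refine (((h1.add h2).add (hg.hasDerivAt_h hα w c₀ ht)).mul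
    (hg.hasDerivAt_cexp (Complex.I * (w : ℂ)) ht)).congr_deriv ?_
  have hz : (g t : ℂ) ≠ 0 := Complex.ofReal_ne_zero.2 hgt.ne'
  have hp : ((g t ^ α : ℝ) : ℂ) ≠ 0 := Complex.ofReal_ne_zero.2 (Real.rpow_pos_of_pos hgt α).ne'
  simp only [Pi.mul_apply, Pi.add_apply, hIntegrand, W]
  rw [Real.rpow_sub hgt 1, Real.rpow_sub hgt α, Real.rpow_add hgt, add_sub_cancel_right,
    Real.rpow_one, Complex.exp_neg]
  have hE := Complex.exp_ne_zero (Complex.I * (w : ℂ) * (g t : ℂ))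
  push_cast at hp ⊢
  field_simp
  ring

lemma contDiffOn_W (hg : IsPhase a r g) (α w : ℝ) (c₀ : ℂ) {q : ℝ → ℂ}
    (hq : ContDiffOn ℝ (r + 1 : ℕ) q (Icc 0 a)) :
    ContDiffOn ℝ r (W a α w g c₀ q) (Icc 0 a) := by
  have hle : (r : WithTop ℕ∞) ≤ (r + 1 : ℕ) := by exact_mod_cast Nat.le_succ r
  have h1 := hg.contDiffOn_ofReal.of_le hle
  have h2 := hg.contDiffOn_deriv_ofReal
  have h3 : ContDiffOn ℝ r (derivWithin q (Icc 0 a)) (Icc 0 a) :=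
    hq.derivWithin hg.uniqueDiffOn (by norm_cast)
  exact (((contDiffOn_const.mul h2).mul contDiffOn_const).add (h1.mul h3)).add
    (((contDiffOn_const.add (contDiffOn_const.mul h1)).mul h2).mul (hq.of_le hle))

/-- The Levin rule integrates exactly the amplitude produced by `W`. -/
lemma rule_eq (hg : IsPhase a r g) (hα : -1 < α) (w : ℝ) (c₀ : ℂ) {q : ℝ → ℂ}
    (hq : ContDiffOn ℝ (r + 1 : ℕ) q (Icc 0 a)) :
    rule a α w g c₀ q = weightedOsc a α w g (W a α w g c₀ q) :=
  (intervalIntegral.integral_eq_sub_of_hasDerivAt_of_le hg.pos.le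
    (hg.continuousOn_primitive hα w c₀ hq.continuousOn)
    (fun _ ht => hg.hasDerivAt_primitive hα w c₀ hq ht)
    (hg.intervalIntegrable_osc hα w (hg.contDiffOn_W α w c₀ hq).continuousOn)).symm

lemma oscIntegral_eq (hg : IsPhase a r g) (α w : ℝ) (f : ℝ → ℂ) :
    oscIntegral a α w f g = weightedOsc a α w g (rhs a α f g) := by
  refine intervalIntegral.integral_congr_ae (Filter.Eventually.of_forall fun t ht => ?_)
  rw [uIoc_of_le hg.pos.le] at ht
  rw [mul_right_comm (rhs a α f g t), hg.rhs_mul_rpow α f ht]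

end IsPhase

/-! ### Finite-dimensional linear algebra and linear combinations of the basis. -/

/-- A perturbation `i w B + D` of a large multiple of an injective square system is uniquely
solvable, with a solution of size `O(1 / w)`. -/
lemma exists_bound_of_perturbation {V Y : Type*} [NormedAddCommGroup V] [NormedSpace ℂ V]
    [FiniteDimensional ℂ V] [NormedAddCommGroup Y] [NormedSpace ℂ Y] [FiniteDimensional ℂ Y]
    (hVY : Module.finrank ℂ V = Module.finrank ℂ Y) (B D : V →ₗ[ℂ] Y)
    (hB : Function.Injective B) (b : Y) :
    ∃ w₀ K : ℝ, 1 ≤ w₀ ∧ ∀ w : ℝ, w₀ ≤ |w| →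
      (∃! p, (Complex.I * (w : ℂ)) • B p + D p = b) ∧
      ∀ p, (Complex.I * (w : ℂ)) • B p + D p = b → ‖(w : ℂ) • p‖ ≤ K := by
  obtain ⟨K, hK, hBK⟩ := B.exists_antilipschitzWith (LinearMap.ker_eq_bot.2 hB)
  have hK' : (0 : ℝ) < K := hK
  set L := ‖LinearMap.toContinuousLinearMap D‖
  have hL : ∀ p, ‖D p‖ ≤ L * ‖p‖ := (LinearMap.toContinuousLinearMap D).le_opNorm
  have hL0 : 0 ≤ L := norm_nonneg _
  have hBn : ∀ p, ‖p‖ ≤ K * ‖B p‖ := fun p => by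
    simpa using hBK.le_mul_dist p 0
  -- The threshold makes the contribution K L ‖p‖ of `D` at most half of |w| ‖p‖, so it is absorbed
  -- on the left.
  have key : ∀ w : ℝ, max 1 (2 * K * L) ≤ |w| → ∀ p,
      |w| * ‖p‖ ≤ 2 * K * ‖(Complex.I * (w : ℂ)) • B p + D p‖ := by
    intro w hw p
    have h1 : |w| * ‖B p‖ ≤ ‖(Complex.I * (w : ℂ)) • B p + D p‖ + ‖D p‖ := by
      have h2 : ‖(Complex.I * (w : ℂ)) • B p‖ = |w| * ‖B p‖ := by
        simp [norm_smul]
      rw [← h2]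
      exact norm_le_add_norm_add _ _
    have h3 : 2 * K * L * ‖p‖ ≤ |w| * ‖p‖ := by
      gcongr; exact (le_max_right _ _).trans hw
    have h4 : |w| * ‖p‖ ≤ K * (|w| * ‖B p‖) := by
      calc |w| * ‖p‖ ≤ |w| * (K * ‖B p‖) := by gcongr; exact hBn p
        _ = _ := by ring
    have h5 : K * (|w| * ‖B p‖) ≤ K * (‖(Complex.I * (w : ℂ)) • B p + D p‖ + L * ‖p‖) := by
      gcongr; exact h1.trans (by gcongr; exact hL p)
    nlinarith
  refine ⟨max 1 (2 * K * L), 2 * K * ‖b‖, le_max_left _ _, fun w hw => ⟨?_, fun p hp => ?_⟩⟩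
  · have hw0 : 0 < |w| := one_pos.trans_le ((le_max_left _ _).trans hw)
    have hinj : Function.Injective ((Complex.I * (w : ℂ)) • B + D) := by
      rw [← LinearMap.ker_eq_bot, LinearMap.ker_eq_bot']
      intro p hp
      have h1 := key w hw p
      rw [show (Complex.I * (w : ℂ)) • B p + D p = 0 from hp, norm_zero, mul_zero] at h1
      exact norm_le_zero_iff.1 (nonpos_of_mul_nonpos_right h1 hw0)
    exact (show Function.Bijective ((Complex.I * (w : ℂ)) • B + D) from
      ⟨hinj, (LinearMap.injective_iff_surjective_of_finrank_eq_finrank hVY).1 hinj⟩).existsUnique b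
  · have := key w hw p
    rw [hp] at this
    simpa [norm_smul] using this

/-- Uniform boundedness for families of functionals on a finite-dimensional space. -/
lemma exists_uniform_bound {ι Y : Type*} [NormedAddCommGroup Y] [NormedSpace ℂ Y]
    [FiniteDimensional ℂ Y] (T : ι → Y →ₗ[ℂ] ℂ) (β : ι → ℝ) (hβ : ∀ i, 0 < β i)
    (h : ∀ y, ∃ C, ∀ i, ‖T i y‖ ≤ C * β i) :
    ∃ C, 0 ≤ C ∧ ∀ i y, ‖T i y‖ ≤ C * β i * ‖y‖ := by
  have : CompleteSpace Y := FiniteDimensional.complete ℂ Y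
  have hn : ∀ i y, ‖(((β i)⁻¹ : ℝ) : ℂ) • LinearMap.toContinuousLinearMap (T i) y‖
      = ‖T i y‖ / β i := fun i y => by
    rw [norm_smul, Complex.norm_real, Real.norm_of_nonneg (inv_nonneg.2 (hβ i).le), inv_mul_eq_div]
    rfl
  obtain ⟨C, hC⟩ := banach_steinhaus
    (g := fun i => (((β i)⁻¹ : ℝ) : ℂ) • LinearMap.toContinuousLinearMap (T i)) fun y => by
      obtain ⟨C, hC⟩ := h y
      refine ⟨C, fun i => ?_⟩
      rw [smul_apply, hn, div_le_iff₀ (hβ i)]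
      exact hC i
  refine ⟨max C 0, le_max_right _ _, fun i y => ?_⟩
  have h1 := ((((β i)⁻¹ : ℝ) : ℂ) • LinearMap.toContinuousLinearMap (T i)).le_of_opNorm_le
    ((hC i).trans (le_max_left C 0)) y
  rw [smul_apply, hn, div_le_iff₀ (hβ i)] at h1
  linarith

/-- The space of functions that are `C^r` on `S`. -/
def smoothOn (S : Set ℝ) (r : ℕ) : Submodule ℂ (ℝ → ℂ) where
  carrier := {u | ContDiffOn ℝ r u S}
  add_mem' hu hv := ContDiffOn.add hu hv
  zero_mem' := contDiffOn_const
  smul_mem' _ _ hu := contDiffOn_const.smul hu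

/-- The `j`-th derivative at `t`, as a linear functional. -/
def jet {S : Set ℝ} {r : ℕ} (hS : UniqueDiffOn ℝ S) {t : ℝ} (ht : t ∈ S) {j : ℕ} (hj : j ≤ r) :
    smoothOn S r →ₗ[ℂ] ℂ where
  toFun u := iteratedDerivWithin j u S t
  map_add' u v := by
    have hle : (j : WithTop ℕ∞) ≤ r := by exact_mod_cast hj
    exact iteratedDerivWithin_add ht hS ((u.2 t ht).of_le hle) ((v.2 t ht).of_le hle)
  map_smul' c u := by
    have hle : (j : WithTop ℕ∞) ≤ r := by exact_mod_cast hj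
    exact iteratedDerivWithin_const_smul ht hS c ((u.2 t ht).of_le hle)

lemma lin_add {M : ℕ} (φ : Fin M → ℝ → ℂ) (c d : Fin M → ℂ) (t : ℝ) :
    lin φ (c + d) t = lin φ c t + lin φ d t := by
  simp [lin, add_mul, Finset.sum_add_distrib]

lemma lin_smul {M : ℕ} (φ : Fin M → ℝ → ℂ) (z : ℂ) (c : Fin M → ℂ) (t : ℝ) :
    lin φ (z • c) t = z * lin φ c t := by
  simp [lin, Finset.mul_sum, mul_assoc]

lemma contDiffOn_lin {M : ℕ} {S : Set ℝ} {k : WithTop ℕ∞} {φ : Fin M → ℝ → ℂ}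
    (hφ : ∀ i, ContDiffOn ℝ k (φ i) S) (c : Fin M → ℂ) : ContDiffOn ℝ k (lin φ c) S :=
  ContDiffOn.sum fun i _ => contDiffOn_const.mul (hφ i)

lemma derivWithin_lin {M : ℕ} {S : Set ℝ} {φ : Fin M → ℝ → ℂ} {t : ℝ}
    (hS : UniqueDiffWithinAt ℝ S t) (hφ : ∀ i, DifferentiableWithinAt ℝ (φ i) S t)
    (c : Fin M → ℂ) :
    derivWithin (lin φ c) S t = lin (fun i => derivWithin (φ i) S) c t :=
  (HasDerivWithinAt.fun_sum fun i _ => (hφ i).hasDerivWithinAt.const_mul (c i)).derivWithin hS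

/-! ### Splitting of 𝓦 in powers of w, and uniform decay. -/

namespace IsPhase

variable {a : ℝ} {r M : ℕ} {g : ℝ → ℝ} {φ : Fin M → ℝ → ℂ}

/-- The part of `𝓦` multiplied by `i w`. -/
def principal (hg : IsPhase a r g)
    (hφ : ∀ k, ContDiffOn ℝ (r + 1 : ℕ) (φ k) (Icc 0 a)) :
    ℂ × (Fin M → ℂ) →ₗ[ℂ] smoothOn (Icc 0 a) r where
  toFun p := ⟨fun t => ((derivWithin g (Icc 0 a) t : ℝ) : ℂ) * (p.1 + (g t : ℂ) * lin φ p.2 t), by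
    have hle : (r : WithTop ℕ∞) ≤ (r + 1 : ℕ) := by exact_mod_cast Nat.le_succ r
    exact hg.contDiffOn_deriv_ofReal.mul (contDiffOn_const.add
      ((hg.contDiffOn_ofReal.mul (contDiffOn_lin hφ p.2)).of_le hle))⟩
  map_add' p q := by
    ext t
    simp only [Prod.fst_add, Prod.snd_add, lin_add, Submodule.coe_add, Pi.add_apply]
    ring
  map_smul' z p := by
    ext t
    simp only [Prod.smul_fst, Prod.smul_snd, lin_smul, Submodule.coe_smul, Pi.smul_apply,
      smul_eq_mul, RingHom.id_apply]
    ring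

/-- The part of `𝓦` independent of `w`. -/
def remainder (hg : IsPhase a r g) (α : ℝ)
    (hφ : ∀ k, ContDiffOn ℝ (r + 1 : ℕ) (φ k) (Icc 0 a)) :
    ℂ × (Fin M → ℂ) →ₗ[ℂ] smoothOn (Icc 0 a) r where
  toFun p := ⟨fun t => (g t : ℂ) * lin (fun k => derivWithin (φ k) (Icc 0 a)) p.2 t
      + (1 + (α : ℂ)) * ((derivWithin g (Icc 0 a) t : ℝ) : ℂ) * lin φ p.2 t, by
    have hle : (r : WithTop ℕ∞) ≤ (r + 1 : ℕ) := by exact_mod_cast Nat.le_succ r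
    have h1 := contDiffOn_lin (fun k => (hφ k).derivWithin (m := r) hg.uniqueDiffOn
      (by norm_cast)) p.2
    exact ((hg.contDiffOn_ofReal.of_le hle).mul h1).add
      ((contDiffOn_const.mul hg.contDiffOn_deriv_ofReal).mul ((contDiffOn_lin hφ p.2).of_le hle))⟩
  map_add' p q := by
    ext t
    simp only [Prod.snd_add, lin_add, Submodule.coe_add, Pi.add_apply]
    ring
  map_smul' z p := by
    ext t
    simp only [Prod.smul_snd, lin_smul, Submodule.coe_smul, Pi.smul_apply,
      smul_eq_mul, RingHom.id_apply]
    ring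

lemma W_eq (hg : IsPhase a r g) (α w : ℝ)
    (hφ : ∀ k, ContDiffOn ℝ (r + 1 : ℕ) (φ k) (Icc 0 a)) (p : ℂ × (Fin M → ℂ)) :
    EqOn (W a α w g p.1 (lin φ p.2))
      ((Complex.I * (w : ℂ)) • hg.principal hφ p + hg.remainder α hφ p :
        smoothOn (Icc 0 a) r) (Icc 0 a) := fun t ht => by
  simp only [W, derivWithin_lin (hg.uniqueDiffOn t ht)
    (fun k => (hφ k).differentiableOn (by simp) t ht), principal, remainder, LinearMap.coe_mk,
    AddHom.coe_mk, Submodule.coe_add, Submodule.coe_smul, Pi.add_apply, Pi.smul_apply, smul_eq_mul]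
  ring

/-- The oscillatory integral as a linear functional of the amplitude. -/
def oscFunctional (hg : IsPhase a r g) {α : ℝ} (hα : -1 < α) (w : ℝ) :
    smoothOn (Icc 0 a) r →ₗ[ℂ] ℂ where
  toFun u := weightedOsc a α w g u
  map_add' u v := by
    have hu : ContDiffOn ℝ r (u : ℝ → ℂ) (Icc 0 a) := u.2
    have hv : ContDiffOn ℝ r (v : ℝ → ℂ) (Icc 0 a) := v.2
    rw [weightedOsc, weightedOsc, weightedOsc, ← intervalIntegral.integral_add
      (hg.intervalIntegrable_osc hα w hu.continuousOn)
      (hg.intervalIntegrable_osc hα w hv.continuousOn)]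
    simp only [Submodule.coe_add, Pi.add_apply, add_mul]
  map_smul' z u := by
    simp only [weightedOsc, Submodule.coe_smul, Pi.smul_apply, smul_eq_mul, RingHom.id_apply,
      mul_assoc, intervalIntegral.integral_const_mul]

lemma oscFunctional_apply (hg : IsPhase a r g) {α : ℝ} (hα : -1 < α) (w : ℝ)
    (u : smoothOn (Icc 0 a) r) : hg.oscFunctional hα w u = weightedOsc a α w g u := rfl

lemma weightedOsc_congr (hg : IsPhase a r g) (α w : ℝ) {u v : ℝ → ℂ} (huv : EqOn u v (Icc 0 a)) :
    weightedOsc a α w g u = weightedOsc a α w g v := by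
  refine intervalIntegral.integral_congr fun t ht => ?_
  rw [uIcc_of_le hg.pos.le] at ht
  simp only [huv ht]

/-- The decay of the oscillatory integral of a `C^r` function with zeros of order `s + 1` at both
ends. -/
lemma exists_norm_oscFunctional_le (hg : IsPhase a r g) {α : ℝ} (hα0 : α ≠ 0) (hα : -1 < α) {s : ℕ}
    (hs : s + 2 ≤ r) (u : smoothOn (Icc 0 a) r) (h0 : VanishesTo (Icc 0 a) (s + 1) u 0)
    (ha : VanishesTo (Icc 0 a) (s + 1) u a) :
    ∃ C, ∀ w : ℝ, 1 ≤ |w| →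
      ‖hg.oscFunctional hα w u‖ ≤ C * |w| ^ (-(s : ℝ) - 1 - min (1 + α) 1) := by
  have hu : ContDiffOn ℝ r (u : ℝ → ℂ) (Icc 0 a) := u.2
  have hgc := hg.contDiffOn_deriv_ofReal.inv fun t ht => hg.deriv_ofReal_ne_zero ht
  -- The decay bound concerns amplitudes g' e, so take e = u / g'. With N = s + 1 it needs class
  -- C^(s+2), whence `s + 2 ≤ r`.
  obtain ⟨C, hC⟩ := hg.exists_norm_weightedOsc_le hα0 hα (s + 1) (by omega)
    (fun t => ((derivWithin g (Icc 0 a) t : ℝ) : ℂ)⁻¹ * (u : ℝ → ℂ) t)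
    ((hgc.mul hu).of_le (by exact_mod_cast hs))
    (h0.mul_left hg.uniqueDiffOn hg.zero_mem (by omega) hgc hu)
    (ha.mul_left hg.uniqueDiffOn hg.end_mem (by omega) hgc hu)
  refine ⟨C, fun w hw => ?_⟩
  have h1 := hC w hw
  rw [hg.weightedOsc_congr (v := u) α w fun t ht =>
    mul_inv_cancel_left₀ (hg.deriv_ofReal_ne_zero ht) _] at h1
  rw [oscFunctional_apply]
  convert h1 using 3
  push_cast
  ring

/-- The bound of `exists_norm_oscFunctional_le` is uniform on finite-dimensional families. -/
lemma exists_norm_oscFunctional_le_mul_norm (hg : IsPhase a r g) {α : ℝ} (hα0 : α ≠ 0)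
    (hα : -1 < α) {s : ℕ} (hs : s + 2 ≤ r) {P : Type*} [NormedAddCommGroup P] [NormedSpace ℂ P]
    [FiniteDimensional ℂ P] (E : P →ₗ[ℂ] smoothOn (Icc 0 a) r) :
    ∃ C, 0 ≤ C ∧ ∀ w : ℝ, 1 ≤ |w| → ∀ v : P, VanishesTo (Icc 0 a) (s + 1) (E v) 0 →
      VanishesTo (Icc 0 a) (s + 1) (E v) a →
      ‖hg.oscFunctional hα w (E v)‖ ≤ C * |w| ^ (-(s : ℝ) - 1 - min (1 + α) 1) * ‖v‖ := by
  have hj : ∀ j : Fin (s + 1), (j : ℕ) ≤ r := fun j => by omega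
  -- The vanishing conditions cut out the kernel of `Z`; the uniform bound is applied on this
  -- subspace, where the pointwise decay is known.
  let Z : P →ₗ[ℂ] (Fin (s + 1) → ℂ) × (Fin (s + 1) → ℂ) :=
    ((LinearMap.pi fun j => jet hg.uniqueDiffOn hg.zero_mem (hj j)).prod
      (LinearMap.pi fun j => jet hg.uniqueDiffOn hg.end_mem (hj j))) ∘ₗ E
  have hZ : ∀ v, v ∈ LinearMap.ker Z ↔ VanishesTo (Icc 0 a) (s + 1) (E v) 0 ∧
      VanishesTo (Icc 0 a) (s + 1) (E v) a := fun v => by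
    rw [LinearMap.mem_ker, Prod.ext_iff, funext_iff, funext_iff]
    exact and_congr ⟨fun h j hj => h ⟨j, hj⟩, fun h j => h j j.2⟩
      ⟨fun h j hj => h ⟨j, hj⟩, fun h j => h j j.2⟩
  obtain ⟨C, hC0, hC⟩ := exists_uniform_bound (ι := {w : ℝ // 1 ≤ |w|})
    (fun w => hg.oscFunctional hα w ∘ₗ E ∘ₗ (LinearMap.ker Z).subtype)
    (fun w => |(w : ℝ)| ^ (-(s : ℝ) - 1 - min (1 + α) 1))
    (fun w => Real.rpow_pos_of_pos (one_pos.trans_le w.2) _) fun v => by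
      obtain ⟨C, hC⟩ := hg.exists_norm_oscFunctional_le hα0 hα hs (E v) ((hZ v).1 v.2).1
        ((hZ v).1 v.2).2
      exact ⟨C, fun w => hC w w.2⟩
  exact ⟨C, hC0, fun w hw v h0 ha => hC ⟨w, hw⟩ ⟨v, (hZ v).2 ⟨h0, ha⟩⟩⟩

end IsPhase

/-! ### The collocation system. -/

namespace IsPhase

variable {a : ℝ} {r M n : ℕ} {g : ℝ → ℝ} {φ : Fin M → ℝ → ℂ}

/-- All the jets at the nodes. -/
def nodeJets (hg : IsPhase a r g) {x : Fin (n + 1) → ℝ} (hx : ∀ l, x l ∈ Icc 0 a)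
    {m : Fin (n + 1) → ℕ} (hm : ∀ l, m l ≤ r + 1) :
    smoothOn (Icc 0 a) r →ₗ[ℂ] ((Σ l, Fin (m l)) → ℂ) :=
  LinearMap.pi fun i => jet hg.uniqueDiffOn (hx i.1)
    (j := i.2) (by have := i.2.2; have := hm i.1; omega)

lemma nodeJets_apply (hg : IsPhase a r g) {x : Fin (n + 1) → ℝ} (hx : ∀ l, x l ∈ Icc 0 a)
    {m : Fin (n + 1) → ℕ} (hm : ∀ l, m l ≤ r + 1) (u : smoothOn (Icc 0 a) r)
    (i : Σ l, Fin (m l)) :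
    hg.nodeJets hx hm u i = iteratedDerivWithin i.2 u (Icc 0 a) (x i.1) := rfl

/-- Unisolvence of the limiting collocation problem. -/
lemma injective_nodeJets_principal (hg : IsPhase a r g)
    (hφ : ∀ k, ContDiffOn ℝ (r + 1 : ℕ) (φ k) (Icc 0 a))
    {x : Fin (n + 1) → ℝ} (hx : ∀ l, x l ∈ Icc 0 a) (hxinj : Function.Injective x)
    (hx0 : x 0 = 0) {m : Fin (n + 1) → ℕ} (hm : ∀ l, m l ≤ r + 1) (hm0 : 1 ≤ m 0)
    (hM : ∑ l, m l = M + 1) (hφC : IsChebyshevSet a (Finset.univ.sup m) φ) :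
    Function.Injective (hg.nodeJets hx hm ∘ₗ hg.principal hφ) := by
  rw [← LinearMap.ker_eq_bot, LinearMap.ker_eq_bot']
  intro p hp
  have hle : (r : WithTop ℕ∞) ≤ (r + 1 : ℕ) := by exact_mod_cast Nat.le_succ r
  have hgr := hg.contDiffOn_ofReal.of_le hle
  have hlin := (contDiffOn_lin hφ p.2).of_le hle
  -- The factor g' never vanishes and can be divided out.
  have h1 : ∀ l, VanishesTo (Icc 0 a) (m l) (fun t => p.1 + (g t : ℂ) * lin φ p.2 t) (x l) :=
    fun l => VanishesTo.of_mul (p := 0) (k := r) hg.uniqueDiffOn (hx l) (hm l)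
      hg.contDiffOn_deriv_ofReal (contDiffOn_const.add (hgr.mul hlin))
      (fun j hj => absurd hj (by omega))
      (by rw [iteratedDerivWithin_zero]; exact hg.deriv_ofReal_ne_zero (hx l))
      fun j hj => congrFun hp ⟨l, j, hj⟩
  have hp1 : p.1 = 0 := by
    simpa [hx0, hg.zero] using (h1 0).apply_eq_zero hm0
  simp only [hp1, zero_add] at h1
  have h2 : ∀ l, VanishesTo (Icc 0 a) (m l - if l = 0 then 1 else 0) (lin φ p.2) (x l) := by
    intro l
    split_ifs with hl
    · subst hl
      refine VanishesTo.of_mul (p := 1) (k := r) hg.uniqueDiffOn (hx 0)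
        (by have := hm 0; omega) hgr hlin (fun j hj => ?_) ?_ ((h1 0).mono (by omega))
      · obtain rfl : j = 0 := by omega
        simp [hx0, hg.zero]
      · rw [iteratedDerivWithin_one, hg.derivWithin_ofReal (hx 0)]
        exact hg.deriv_ofReal_ne_zero (hx 0)
    · refine VanishesTo.of_mul (p := 0) (k := r) hg.uniqueDiffOn (hx l) (hm l) hgr hlin
        (fun j hj => absurd hj (by omega)) ?_ (h1 l)
      rw [iteratedDerivWithin_zero]
      have hxl : x l ≠ 0 := fun h => hl (hxinj (h.trans hx0.symm))
      exact Complex.ofReal_ne_zero.2 (hg.pos_of_mem ⟨(hx l).1.lt_of_ne' hxl, (hx l).2⟩).ne'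
  refine Prod.ext hp1 (by_contra fun hp2 => ?_)
  -- The multiplicities are m_l, less one at 0; they sum to M, against the strict bound.
  have h3 := hφC p.2 hp2 (Finset.univ.map ⟨x, hxinj⟩)
    (Function.extend x (fun l => m l - if l = 0 then 1 else 0) 0) fun t ht => by
      obtain ⟨l, -, rfl⟩ := Finset.mem_map.1 ht
      rw [Function.Embedding.coeFn_mk, hxinj.extend_apply]
      exact ⟨hx l, (Nat.sub_le _ _).trans (Finset.le_sup (Finset.mem_univ l)), h2 l⟩
  rw [Finset.sum_map] at h3
  simp only [Function.Embedding.coeFn_mk, hxinj.extend_apply] at h3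
  rw [Fin.sum_univ_succ] at h3 hM
  simp only [if_true, Fin.succ_ne_zero, if_false, Nat.sub_zero] at h3
  omega

/-- Puts the system in the form (iwB + D)p = b with B, D and b independent of w. -/
lemma isCollocationSolution_iff (hg : IsPhase a r g) (α w : ℝ) {f : ℝ → ℂ}
    (hf : ContDiffOn ℝ r f (Icc 0 a)) (hφ : ∀ k, ContDiffOn ℝ (r + 1 : ℕ) (φ k) (Icc 0 a))
    {x : Fin (n + 1) → ℝ} (hx : ∀ l, x l ∈ Icc 0 a)
    {m : Fin (n + 1) → ℕ} (hm : ∀ l, m l ≤ r + 1) (p : ℂ × (Fin M → ℂ)) :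
    IsCollocationSolution a α w f g φ x m p.1 p.2 ↔
      (Complex.I * (w : ℂ)) • (hg.nodeJets hx hm ∘ₗ hg.principal hφ) p
        + (hg.nodeJets hx hm ∘ₗ hg.remainder α hφ) p
        = hg.nodeJets hx hm ⟨rhs a α f g, hg.contDiffOn_rhs α hf⟩ := by
  rw [LinearMap.comp_apply, LinearMap.comp_apply, ← map_smul, ← map_add, funext_iff]
  have h1 : ∀ l j, iteratedDerivWithin j (W a α w g p.1 (lin φ p.2)) (Icc 0 a) (x l)
      = iteratedDerivWithin j ((Complex.I * (w : ℂ)) • hg.principal hφ p + hg.remainder α hφ p :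
        smoothOn (Icc 0 a) r) (Icc 0 a) (x l) := fun l j =>
    iteratedDerivWithin_congr (hg.W_eq α w hφ p) (hx l)
  exact ⟨fun h i => (h1 _ _).symm.trans (h i.1 i.2 i.2.2),
    fun h l j hj => (h1 _ _).trans (h ⟨l, j, hj⟩)⟩

end IsPhase

end Levin

end

/-! ### The error estimate. -/

theorem theorem2p4
    (a α : ℝ) (ha : 0 < a) (hα0 : 0 < |α|) (hα1 : |α| < 1)
    (s n M r : ℕ)
    (x : Fin (n + 1) → ℝ) (hx : StrictMono x) (hx0 : x 0 = 0) (hxn : x (Fin.last n) = a)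
    (m : Fin (n + 1) → ℕ) (hm : ∀ l, 1 ≤ m l)
    (hm0 : m 0 = s + 1) (hmn : m (Fin.last n) = s + 1)
    (hM : ∑ l, m l = M + 1)
    (hrs : s + 2 ≤ r) (hrm : ∀ l, m l ≤ r + 1)
    (f : ℝ → ℂ) (hf : ContDiffOn ℝ (r : WithTop ℕ∞) f (Set.Icc 0 a))
    (g : ℝ → ℝ) (hg : ContDiffOn ℝ ((r + 1 : ℕ) : WithTop ℕ∞) g (Set.Icc 0 a))
    (hg0 : g 0 = 0) (hg' : ∀ t ∈ Set.Icc 0 a, 0 < derivWithin g (Set.Icc 0 a) t)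
    (φ : Fin M → ℝ → ℂ)
    (hφ : ∀ k, ContDiffOn ℝ ((r + 1 : ℕ) : WithTop ℕ∞) (φ k) (Set.Icc 0 a))
    (hφC : Levin.IsChebyshevSet a (Finset.univ.sup m) φ) :
    ∃ w₀ C : ℝ, ∀ w : ℝ, w₀ ≤ |w| →
      (∃! p : ℂ × (Fin M → ℂ), Levin.IsCollocationSolution a α w f g φ x m p.1 p.2) ∧
      ∀ (c₀ : ℂ) (c : Fin M → ℂ), Levin.IsCollocationSolution a α w f g φ x m c₀ c →
        ‖Levin.oscIntegral a α w f g - Levin.rule a α w g c₀ (Levin.lin φ c)‖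
          ≤ C * |w| ^ (-(s : ℝ) - 1 - min (1 + α) 1) := by
  have hP : Levin.IsPhase a r g := ⟨ha, hg, hg0, hg'⟩
  have hα : -1 < α := (abs_lt.1 hα1).1
  have hα0' : α ≠ 0 := abs_pos.1 hα0
  have hxI : ∀ l, x l ∈ Set.Icc 0 a := fun l =>
    ⟨hx0 ▸ hx.monotone (Fin.zero_le l), hxn ▸ hx.monotone (Fin.le_last l)⟩
  have hinj := hP.injective_nodeJets_principal hφ hxI hx.injective hx0 hrm (hm 0) hM hφC
  obtain ⟨w₀, K, hw₀, hsol⟩ := Levin.exists_bound_of_perturbation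
    (by simp [hM, add_comm]) _ (hP.nodeJets hxI hrm ∘ₗ hP.remainder α hφ) hinj
    (hP.nodeJets hxI hrm ⟨Levin.rhs a α f g, hP.contDiffOn_rhs α hf⟩)
  -- the defect `f₁ - 𝓦[c₀, q]` depends linearly on `(1, w c, c)`
  let F : Levin.smoothOn (Set.Icc 0 a) r := ⟨Levin.rhs a α f g, hP.contDiffOn_rhs α hf⟩
  let E : ℂ × (ℂ × (Fin M → ℂ)) × (ℂ × (Fin M → ℂ)) →ₗ[ℂ] Levin.smoothOn (Set.Icc 0 a) r :=
    (LinearMap.toSpanSingleton ℂ _ F).coprod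
      ((-Complex.I • hP.principal hφ).coprod (-hP.remainder α hφ))
  obtain ⟨C, hC0, hC⟩ := hP.exists_norm_oscFunctional_le_mul_norm hα0' hα hrs E
  refine ⟨w₀, C * max 1 K, fun w hw => ⟨?_, fun c₀ c hc => ?_⟩⟩
  · simpa only [hP.isCollocationSolution_iff α w hf hφ hxI hrm] using (hsol w hw).1
  · have hw1 : 1 ≤ |w| := hw₀.trans hw
    set p : ℂ × (Fin M → ℂ) := (c₀, c)
    have hcol := (hP.isCollocationSolution_iff α w hf hφ hxI hrm p).1 hc
    have hwp := (hsol w hw).2 p hcol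
    -- All dependence on w is carried by `v`, so the constant attached to `E` serves every w.
    set v : ℂ × (ℂ × (Fin M → ℂ)) × (ℂ × (Fin M → ℂ)) := (1, (w : ℂ) • p, p)
    have hE : E v = F - ((Complex.I * (w : ℂ)) • hP.principal hφ p + hP.remainder α hφ p) := by
      simp only [E, v, LinearMap.coprod_apply, LinearMap.toSpanSingleton_apply, one_smul,
        LinearMap.smul_apply, LinearMap.neg_apply, map_smul, neg_smul]
      module
    have hjets : hP.nodeJets hxI hrm (E v) = 0 := by
      rw [hE, map_sub, map_add, map_smul, sub_eq_zero]
      exact hcol.symm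
    have hv0 : Levin.VanishesTo (Set.Icc 0 a) (s + 1) (E v) 0 := fun j hj => by
      have := congrFun hjets ⟨0, j, by omega⟩
      rwa [hP.nodeJets_apply, hx0] at this
    have hva : Levin.VanishesTo (Set.Icc 0 a) (s + 1) (E v) a := fun j hj => by
      have := congrFun hjets ⟨Fin.last n, j, by omega⟩
      rwa [hP.nodeJets_apply, hxn] at this
    have hvn : ‖v‖ ≤ max 1 K := by
      have hpn : ‖p‖ ≤ ‖(w : ℂ) • p‖ := by
        rw [norm_smul, Complex.norm_real, Real.norm_eq_abs]
        exact le_mul_of_one_le_left (norm_nonneg _) hw1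
      simp only [v, Prod.norm_def (E := ℂ) (F := (ℂ × (Fin M → ℂ)) × (ℂ × (Fin M → ℂ))), norm_one,
        Prod.norm_def (E := ℂ × (Fin M → ℂ)) (F := ℂ × (Fin M → ℂ))]
      exact max_le_max le_rfl (max_le hwp (hpn.trans hwp))
    have herr : Levin.oscIntegral a α w f g - Levin.rule a α w g c₀ (Levin.lin φ c)
        = hP.oscFunctional hα w (E v) := by
      rw [hE, map_sub, hP.oscIntegral_eq, hP.rule_eq hα w c₀ (Levin.contDiffOn_lin hφ c),
        hP.weightedOsc_congr α w (hP.W_eq α w hφ p)]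
      rfl
    rw [herr]
    refine (hC w hw1 v hv0 hva).trans ?_
    rw [mul_right_comm]
    gcongr
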